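/- **Parameters.** Let $M\ge 1$ be the number of beams, $\theta_B=2\pi/M$; $\lambda_{BS}>0$ and $\lambda_{cl}\ge 0$ the densities of base stations (BSs) and clutter scatterers; $\gamma\ge 0$ and $p_{LOS}(r)=e^{-\gamma r}$; $\eta_L,\eta_N>0$, $C_L,C_N>0$, $m_L,m_N>0$ the LoS/NLoS path-loss exponents, intercepts and Nakagami parameters; $P_s>0$, $P_c\ge 0$ the sensing and communication powers; $G_m>0$ the gain, $\lambda>0$ the wavelength, $\sigma_{av_t},\sigma_{av_{cl}}>0$ the mean radar cross sections (RCS) of target and clutter; $K_B,T,W_b,c>0$; $\zeta\ge 0$ the residual self-interference fraction. Fix a threshold $\phi_s>0$, a reference BS at the origin of $\mathbb R^2$, a target at $x_t\in\mathbb R^2$ with $\|x_t\|=R_1>0$, and a measurable resolution cell $A_{rm}\subset\mathbb R^2$ of area $\frac{c\,\theta_B R_1}{2W_b}$. Put $\kappa=\frac{P_sG_m^2\lambda^2}{(4\pi)^3}$. **Random model (independent interference components).** All the following random elements are mutually independent. "Exp$(a)$" is the exponential law of mean $a$. - Swerling-I target RCS $\sigma_{tm}\sim$ Exp$(\sigma_{av_t})$.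 - Intra-clutter: $\boldsymbol\Phi_{cl}$ is a homogeneous Poisson point process (PPP) of intensity $\lambda_{cl}$ whose points carry i.i.d. RCSs $\sigma_{cm}\sim$ Exp$(\sigma_{av_{cl}})$, and $I_0=\kappa R_1^{-2\eta_L}\sum_{cl\in\boldsymbol\Phi_{cl}\cap A_{rm}}\sigma_{cm}$. - Direct interference: $R_d$ has density $2\pi\lambda_{BS}R_d e^{-\pi\lambda_{BS}R_d^2}$ on $[0,\infty)$; $\boldsymbol\Phi_{L_s}$, $\boldsymbol\Phi_{N_s}$ are PPPs of intensities $p_{LOS}(\|x\|)\lambda_{BS}/M^2$ and $(1-p_{LOS}(\|x\|))\lambda_{BS}/M^2$ whose points carry i.i.d. unit-mean Gamma fading gains $h_{L,i}$, $h_{N,i}$ of shapes $m_L$, $m_N$; the interference is $I_{L_s}=\sum_{x_i\in\boldsymbol\Phi_{L_s},\|x_i\|\ge R_d}P_c h_{L,i}G_m^2C_L\|x_i\|^{-\eta_L}$, and likewise $I_{N_s}$ with $N$ in place of $L$. - Inter-clutter: the distance $R_{IC}$ has density $2\pi\lambda_{BS}R_{IC}e^{-\pi\lambda_{BS}(R_{IC}^2-R_1^2)}$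 on $[R_1,\infty)$; the bistatic angle $\beta$ is uniform on $[0,\pi]$; $\boldsymbol\Phi_1,\boldsymbol\Phi_2$ are two PPPs of intensity $p_{LOS}(\|x-x_t\|)\lambda_{BS}/M$. Each point $x_n$ of $\boldsymbol\Phi_1$ carries its own target RCS $\sigma_{tm,n}\sim$ Exp$(\sigma_{av_t})$; each point $x_n$ of $\boldsymbol\Phi_2$ carries its own independent copy $\boldsymbol\Phi_{cl}^{(n)}$ of the clutter process with its RCSs. With $R_n=\|x_n-x_t\|$, $$I_{IC1}=\sum_{x_n\in\boldsymbol\Phi_1,\,R_n\ge R_{IC}}\cos\tfrac\beta2\,R_n^{-\eta_L}\sigma_{tm,n},\qquad I_{IC2}=\sum_{x_n\in\boldsymbol\Phi_2,\,R_n\ge R_{IC}}\cos\tfrac\beta2\,R_n^{-\eta_L}\sum_{cl\in\boldsymbol\Phi^{(n)}_{cl}\cap A_{rm}}\sigma_{cm}.$$ The monostatic SINR (equal to $0$ when the denominator is infinite) is $$\mathrm{SINR}_M=\frac{\kappa R_1^{-2\eta_L}\sigma_{tm}}{I_0+\kappa R_1^{-\eta_L}(I_{IC1}+I_{IC2})+K_BTW_b+I_{L_s}+I_{N_s}+P_c\zeta}.$$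 **Theorem 1.** Let $s_1=\frac{\phi_sR_1^{\eta_L}}{\sigma_{av_t}}$ and $s_2=\frac{\phi_s(4\pi)^3R_1^{2\eta_L}}{P_sG_m^2\lambda^2\sigma_{av_t}}$. With the convention $e^{-\infty}=0$, the monostatic sensing coverage probability $\mathcal P_M(R_1)=\mathbb P(\mathrm{SINR}_M>\phi_s)$ is $$\mathcal P_M(R_1)=\mathcal L_{\rm intra}\cdot\mathcal L_{\rm inter}(s_1)\cdot e^{-s_2K_BTW_b}\cdot\mathcal L_{\rm direct}(s_2)\cdot e^{-s_2P_c\zeta},$$ where $$\mathcal L_{\rm intra}=\mathbb E\Big[e^{-\frac{\phi_s}{\sigma_{av_t}}\sum_{cl\in\boldsymbol\Phi_{cl}\cap A_{rm}}\sigma_{cm}}\Big]=\exp\Big(-\lambda_{cl}\tfrac{c\theta_BR_1}{2W_b}\tfrac{\phi_s\sigma_{av_{cl}}}{\sigma_{av_t}+\phi_s\sigma_{av_{cl}}}\Big),$$ $$\mathcal L_{\rm inter}(s_1)=\mathbb E\big[e^{-s_1(I_{IC1}+I_{IC2})}\big]=\int_{R_1}^\infty\!\int_0^\pi\mathcal L_{I_{IC1}}\,\mathcal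 L_{I_{IC2}}\;2\lambda_{BS}R_{IC}\,e^{-\pi\lambda_{BS}(R_{IC}^2-R_1^2)}\,d\beta\,dR_{IC},$$ $$\mathcal L_{I_{IC1}}=\exp\Big(-\tfrac{2\pi\lambda_{BS}}{M}\int_{R_{IC}}^\infty p_{LOS}(r)\Big(1-\tfrac1{1+s_1\cos(\beta/2)r^{-\eta_L}\sigma_{av_t}}\Big)r\,dr\Big),$$ $$\mathcal L_{I_{IC2}}=\exp\Big(-\tfrac{\lambda_{BS}}{M}\int_{R_{IC}}^\infty p_{LOS}(r)\Big(1-\exp\Big(-\lambda_{cl}\tfrac{c\theta_BR_1}{2W_b}\tfrac{s_1\cos(\beta/2)r^{-\eta_L}\sigma_{av_{cl}}}{1+s_1\cos(\beta/2)r^{-\eta_L}\sigma_{av_{cl}}}\Big)\Big)2\pi r\,dr\Big),$$ $$\mathcal L_{\rm direct}(s_2)=\mathbb E\big[e^{-s_2(I_{L_s}+I_{N_s})}\big]=\int_0^\infty\mathcal L_{I_{L_s}}\,\mathcal L_{I_{N_s}}\;2\pi\lambda_{BS}R_d\,e^{-\pi\lambda_{BS}R_d^2}\,dR_d,$$ $$\mathcal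 L_{I_{L_s}}=\exp\Big(-\tfrac{2\pi\lambda_{BS}}{M^2}\int_{R_d}^\infty p_{LOS}(r)\Big(1-\big(1+\tfrac{s_2P_cG_m^2C_Lr^{-\eta_L}}{m_L}\big)^{-m_L}\Big)r\,dr\Big),$$ $$\mathcal L_{I_{N_s}}=\exp\Big(-\tfrac{2\pi\lambda_{BS}}{M^2}\int_{R_d}^\infty(1-p_{LOS}(r))\Big(1-\big(1+\tfrac{s_2P_cG_m^2C_Nr^{-\eta_N}}{m_N}\big)^{-m_N}\Big)r\,dr\Big).$$ -/

import Mathlib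

open MeasureTheory ProbabilityTheory
open scoped ENNReal

namespace ISAC

noncomputable section

/-! ### Point processes -/

/-- The Euclidean plane, in which base stations (BSs) and scatterers are located. -/
abbrev Plane := EuclideanSpace ℝ (Fin 2)

/-- An enumerated random configuration of points: `count ω` points (possibly infinitely many),
namely `pt i ω` for the indices `i < count ω`. The values `pt i ω` with `i ≥ count ω` are not
points of the configuration. -/
structure PointProcess (Ω E : Type*) where
  count : Ω → ℕ∞
  pt : ℕ → Ω → E

namespace PointProcess

variable {Ω E : Type*}

/-- Indices of the points that lie in `B`. -/
def idx (Φ : PointProcess Ω E) (B : Set E) (ω : Ω) : Set ℕ :=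
  {i | (i : ℕ∞) < Φ.count ω ∧ Φ.pt i ω ∈ B}

/-- Number of points in `B`. -/
def numIn (Φ : PointProcess Ω E) (B : Set E) (ω : Ω) : ℕ∞ := (Φ.idx B ω).encard

/-- The sum of `f i x` over the points `x` (with index `i`) of the process that lie in `B`. The
index gives access to the mark attached to the point. -/
def sumIn (Φ : PointProcess Ω E) (B : Set E) (f : ℕ → E → ℝ≥0∞) (ω : Ω) : ℝ≥0∞ :=
  ∑' i : Φ.idx B ω, f i (Φ.pt i ω)

/-- The σ-algebra generated by the process. -/
@[reducible] def sigma [MeasurableSpace E] (Φ : PointProcess Ω E) : MeasurableSpace Ω :=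
  MeasurableSpace.comap (fun ω => (Φ.count ω, fun i => Φ.pt i ω)) inferInstance

/-- `Φ` is a Poisson point process with intensity measure `Λ`: the number of points in a set `B` of
finite intensity is Poisson with mean `Λ B`, and the numbers of points in disjoint sets are
independent. -/
structure IsPoisson [MeasurableSpace E] [MeasurableSpace Ω] (Φ : PointProcess Ω E)
    (Λ : Measure E) (μ : Measure Ω) : Prop where
  measurable_count : Measurable Φ.count
  measurable_pt : ∀ i, Measurable (Φ.pt i)
  hasLaw_numIn : ∀ B : Set E, MeasurableSet B → Λ B ≠ ⊤ →
    HasLaw (Φ.numIn B) ((poissonMeasure (Λ B).toNNReal).map (fun n : ℕ => (n : ℕ∞))) μ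
  indep_numIn : ∀ (n : ℕ) (B : Fin n → Set E), (∀ j, MeasurableSet (B j)) →
    Pairwise (fun j k => Disjoint (B j) (B k)) → iIndepFun (fun j => Φ.numIn (B j)) μ

end PointProcess

/-! ### System parameters and distributions -/

/-- The deterministic parameters of the network. -/
structure Params where
  /-- number of beams (and of frequency blocks) per BS -/
  M : ℕ
  /-- BS density -/
  lamBS : ℝ
  /-- clutter scatterer density -/
  lamCl : ℝ
  /-- blockage parameter -/
  γ : ℝ
  /-- LoS and NLoS path-loss exponents -/
  ηL : ℝ
  ηN : ℝ
  /-- LoS and NLoS path-loss intercepts -/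
  CL : ℝ
  CN : ℝ
  /-- LoS and NLoS Nakagami shape parameters -/
  mL : ℝ
  mN : ℝ
  /-- sensing and communication powers -/
  Ps : ℝ
  Pc : ℝ
  /-- antenna gain -/
  Gm : ℝ
  /-- wavelength -/
  wavelength : ℝ
  /-- average RCS of the target and of a clutter scatterer -/
  σt : ℝ
  σcl : ℝ
  /-- Boltzmann constant, temperature, bandwidth, speed of light -/
  kB : ℝ
  T : ℝ
  Wb : ℝ
  c : ℝ
  /-- fraction of power remaining after self-interference cancellation -/
  ζ : ℝ
  M_pos : 0 < M
  lamBS_pos : 0 < lamBS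
  lamCl_nonneg : 0 ≤ lamCl
  γ_nonneg : 0 ≤ γ
  ηL_pos : 0 < ηL
  ηN_pos : 0 < ηN
  CL_pos : 0 < CL
  CN_pos : 0 < CN
  mL_pos : 0 < mL
  mN_pos : 0 < mN
  Ps_pos : 0 < Ps
  Pc_nonneg : 0 ≤ Pc
  Gm_pos : 0 < Gm
  wavelength_pos : 0 < wavelength
  σt_pos : 0 < σt
  σcl_pos : 0 < σcl
  kB_pos : 0 < kB
  T_pos : 0 < T
  Wb_pos : 0 < Wb
  c_pos : 0 < c
  ζ_nonneg : 0 ≤ ζ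

namespace Params

variable (p : Params)

/-- Probability that a link of length `r` is LoS. -/
def pLOS (r : ℝ) : ℝ := Real.exp (-(p.γ * r))

/-- The 3-dB beamwidth. -/
def θB : ℝ := 2 * Real.pi / p.M

/-- Area of the monostatic range resolution cell for a target at distance `R₁`. -/
def cellArea (R₁ : ℝ) : ℝ := p.c * p.θB * R₁ / (2 * p.Wb)

/-- Density of the distance to the nearest BS. -/
def nearestPDF (r : ℝ) : ℝ :=
  if 0 ≤ r then 2 * Real.pi * p.lamBS * r * Real.exp (-(Real.pi * p.lamBS * r ^ 2)) else 0

/-- Density of the distance to the second nearest BS, given the distance `R₁` to the nearest. -/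
def secondPDF (R₁ r : ℝ) : ℝ :=
  if R₁ ≤ r then
    2 * (p.lamBS * Real.pi) * r * Real.exp (-(p.lamBS * Real.pi * (r ^ 2 - R₁ ^ 2)))
  else 0

/-- Intensity of the LoS direct interferers (reference BS at the origin). -/
def losIntensity : Measure Plane :=
  volume.withDensity fun x => ENNReal.ofReal (p.pLOS ‖x‖ * (p.lamBS / (p.M : ℝ) ^ 2))

/-- Intensity of the NLoS direct interferers (reference BS at the origin). -/
def nlosIntensity : Measure Plane :=
  volume.withDensity fun x => ENNReal.ofReal ((1 - p.pLOS ‖x‖) * (p.lamBS / (p.M : ℝ) ^ 2))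

/-- Intensity of the BSs that generate inter-clutter signals, for a target at `xt`. -/
def icIntensity (xt : Plane) : Measure Plane :=
  volume.withDensity fun x => ENNReal.ofReal (p.pLOS (dist x xt) * (p.lamBS / p.M))

/-- Intensity of the clutter scatterers. -/
def clutterIntensity : Measure Plane := ENNReal.ofReal p.lamCl • volume

end Params

/-- Density of the uniform distribution on `[0, π]`. -/
def anglePDF (β : ℝ) : ℝ := if 0 ≤ β ∧ β ≤ Real.pi then 1 / Real.pi else 0

/-- The measure on the line with density `f`. -/
def lawOfPDF (f : ℝ → ℝ) : Measure ℝ := volume.withDensity fun x => ENNReal.ofReal (f x)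

/-- `e ^ (-x)` for `0 ≤ x ≤ ∞`, with `e ^ (-∞) = 0`. -/
def expNeg (x : ℝ≥0∞) : ℝ≥0∞ := EReal.exp (-(x : EReal))

/-! ### The random model -/

/-- The primitive random elements of the monostatic sensing model. Each component of the
denominator of the SINR has its own realizations of the point processes and radar cross sections
that enter it, and every inter-clutter interferer has its own realization of the clutter. The
protection radius of the direct interference is common to its LoS and NLoS part; the protection
radius and the bistatic angle of the inter-clutter interference are common to its two parts. -/
structure Sources (Ω : Type*) where
  /-- RCS of the target in the desired echo -/
  targetRCS : Ω → ℝ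
  /-- clutter scatterers and their RCSs, intra-clutter interference -/
  clutter : PointProcess Ω Plane
  clutterRCS : ℕ → Ω → ℝ
  /-- protection radius, LoS and NLoS interferers and their fading gains, direct interference -/
  Rd : Ω → ℝ
  los : PointProcess Ω Plane
  hL : ℕ → Ω → ℝ
  nlos : PointProcess Ω Plane
  hN : ℕ → Ω → ℝ
  /-- protection radius and bistatic angle, inter-clutter interference -/
  Ric : Ω → ℝ
  β : Ω → ℝ
  /-- interferers whose signals are reflected by the target, and the RCS met by each of them -/
  ic1 : PointProcess Ω Plane
  ic1RCS : ℕ → Ω → ℝ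
  /-- interferers whose signals are reflected by scatterers, and the scatterers and RCSs met by
  each of them -/
  ic2 : PointProcess Ω Plane
  ic2Clutter : ℕ → PointProcess Ω Plane
  ic2RCS : ℕ → ℕ → Ω → ℝ

/-- Labels of the primitive random elements. -/
inductive Label where
  | targetRCS
  | clutter
  | clutterRCS (i : ℕ)
  | Rd
  | los
  | hL (i : ℕ)
  | nlos
  | hN (i : ℕ)
  | Ric
  | β
  | ic1
  | ic1RCS (n : ℕ)
  | ic2
  | ic2Clutter (n : ℕ)
  | ic2RCS (n i : ℕ)

namespace Sources

variable {Ω : Type*} (S : Sources Ω)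

/-- The σ-algebra generated by each primitive random element. -/
@[reducible] def sigma : Label → MeasurableSpace Ω
  | .targetRCS => MeasurableSpace.comap S.targetRCS inferInstance
  | .clutter => S.clutter.sigma
  | .clutterRCS i => MeasurableSpace.comap (S.clutterRCS i) inferInstance
  | .Rd => MeasurableSpace.comap S.Rd inferInstance
  | .los => S.los.sigma
  | .hL i => MeasurableSpace.comap (S.hL i) inferInstance
  | .nlos => S.nlos.sigma
  | .hN i => MeasurableSpace.comap (S.hN i) inferInstance
  | .Ric => MeasurableSpace.comap S.Ric inferInstance
  | .β => MeasurableSpace.comap S.β inferInstance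
  | .ic1 => S.ic1.sigma
  | .ic1RCS n => MeasurableSpace.comap (S.ic1RCS n) inferInstance
  | .ic2 => S.ic2.sigma
  | .ic2Clutter n => (S.ic2Clutter n).sigma
  | .ic2RCS n i => MeasurableSpace.comap (S.ic2RCS n i) inferInstance

/-- `X` is a random variable with law `ν`. -/
def IsRV [MeasurableSpace Ω] (X : Ω → ℝ) (ν : Measure ℝ) (μ : Measure Ω) : Prop :=
  Measurable X ∧ HasLaw X ν μ

/-- The primitive random elements are mutually independent and have the laws of the model, for a
target at `xt` at distance `R₁`: Poisson point processes, Swerling-I (exponential) target RCSs,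
exponential (Weibull of shape 1) clutter RCSs, unit-mean Gamma (Nakagami) fading gains. -/
structure IsModel [MeasurableSpace Ω] (p : Params) (xt : Plane) (R₁ : ℝ) (μ : Measure Ω) :
    Prop where
  targetRCS : IsRV S.targetRCS (expMeasure (1 / p.σt)) μ
  clutter : S.clutter.IsPoisson p.clutterIntensity μ
  clutterRCS : ∀ i, IsRV (S.clutterRCS i) (expMeasure (1 / p.σcl)) μ
  Rd : IsRV S.Rd (lawOfPDF p.nearestPDF) μ
  los : S.los.IsPoisson p.losIntensity μ
  hL : ∀ i, IsRV (S.hL i) (gammaMeasure p.mL p.mL) μ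
  nlos : S.nlos.IsPoisson p.nlosIntensity μ
  hN : ∀ i, IsRV (S.hN i) (gammaMeasure p.mN p.mN) μ
  Ric : IsRV S.Ric (lawOfPDF (p.secondPDF R₁)) μ
  β : IsRV S.β (lawOfPDF anglePDF) μ
  ic1 : S.ic1.IsPoisson (p.icIntensity xt) μ
  ic1RCS : ∀ n, IsRV (S.ic1RCS n) (expMeasure (1 / p.σt)) μ
  ic2 : S.ic2.IsPoisson (p.icIntensity xt) μ
  ic2Clutter : ∀ n, (S.ic2Clutter n).IsPoisson p.clutterIntensity μ
  ic2RCS : ∀ n i, IsRV (S.ic2RCS n i) (expMeasure (1 / p.σcl)) μ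
  indep : iIndep S.sigma μ

/-! ### Interference terms and the SINR -/

variable (p : Params) (xt : Plane) (A : Set Plane) (R₁ : ℝ)

/-- Bistatic RCS corresponding to the monostatic RCS `σ` at bistatic angle `β`. -/
def bistaticRCS (σ β : ℝ) : ℝ := σ * Real.cos (β / 2)

/-- Echo power for transmitter-scatterer distance `R`, scatterer-receiver distance `R'` and RCS
`σ` (LoS radar range equation). -/
def echoPower (σ R R' : ℝ) : ℝ≥0∞ :=
  ENNReal.ofReal (p.Ps * p.Gm ^ 2 * σ * p.wavelength ^ 2 /
    ((4 * Real.pi) ^ 3 * R ^ p.ηL * R' ^ p.ηL))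

/-- Power of the desired echo. -/
def signal (ω : Ω) : ℝ≥0∞ :=
  ENNReal.ofReal (p.Ps * p.Gm ^ 2 * S.targetRCS ω * p.wavelength ^ 2 /
    ((4 * Real.pi) ^ 3 * R₁ ^ (2 * p.ηL)))

/-- Intra-clutter interference from the scatterers in the resolution cell `A`. -/
def intraClutter (ω : Ω) : ℝ≥0∞ :=
  S.clutter.sumIn A (fun i _ => ENNReal.ofReal
    (p.Ps * p.Gm ^ 2 * S.clutterRCS i ω * p.wavelength ^ 2 /
      ((4 * Real.pi) ^ 3 * R₁ ^ (2 * p.ηL)))) ω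

/-- Inter-clutter interference reflected from the target. -/
def interClutter1 (ω : Ω) : ℝ≥0∞ :=
  S.ic1.sumIn {x | S.Ric ω ≤ dist x xt}
    (fun n x => echoPower p (bistaticRCS (S.ic1RCS n ω) (S.β ω)) R₁ (dist x xt)) ω

/-- Inter-clutter interference reflected from the scatterers in the resolution cell `A`. -/
def interClutter2 (ω : Ω) : ℝ≥0∞ :=
  S.ic2.sumIn {x | S.Ric ω ≤ dist x xt}
    (fun n x => (S.ic2Clutter n).sumIn A
      (fun i _ => echoPower p (bistaticRCS (S.ic2RCS n i ω) (S.β ω)) R₁ (dist x xt)) ω) ω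

/-- LoS direct interference at the reference BS. -/
def directLoS (ω : Ω) : ℝ≥0∞ :=
  S.los.sumIn {x | S.Rd ω ≤ ‖x‖}
    (fun i x => ENNReal.ofReal (p.Pc * S.hL i ω * p.Gm ^ 2 * p.CL * ‖x‖ ^ (-p.ηL))) ω

/-- NLoS direct interference at the reference BS. -/
def directNLoS (ω : Ω) : ℝ≥0∞ :=
  S.nlos.sumIn {x | S.Rd ω ≤ ‖x‖}
    (fun i x => ENNReal.ofReal (p.Pc * S.hN i ω * p.Gm ^ 2 * p.CN * ‖x‖ ^ (-p.ηN))) ω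

/-- The monostatic SINR. -/
def sinr (ω : Ω) : ℝ≥0∞ :=
  S.signal p R₁ ω /
    (S.intraClutter p A R₁ ω + S.interClutter1 p xt R₁ ω + S.interClutter2 p xt A R₁ ω
      + ENNReal.ofReal (p.kB * p.T * p.Wb) + S.directLoS p ω + S.directNLoS p ω
      + ENNReal.ofReal (p.Pc * p.ζ))

/-- Total RCS of the scatterers in the resolution cell. -/
def clutterSum (ω : Ω) : ℝ≥0∞ :=
  S.clutter.sumIn A (fun i _ => ENNReal.ofReal (S.clutterRCS i ω)) ω

/-- Normalized inter-clutter interference reflected from the target. -/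
def IIC1 (ω : Ω) : ℝ≥0∞ :=
  S.ic1.sumIn {x | S.Ric ω ≤ dist x xt}
    (fun n x => ENNReal.ofReal
      (Real.cos (S.β ω / 2) * dist x xt ^ (-p.ηL) * S.ic1RCS n ω)) ω

/-- Normalized inter-clutter interference reflected from scatterers. -/
def IIC2 (ω : Ω) : ℝ≥0∞ :=
  S.ic2.sumIn {x | S.Ric ω ≤ dist x xt}
    (fun n x => ENNReal.ofReal (Real.cos (S.β ω / 2) * dist x xt ^ (-p.ηL)) *
      (S.ic2Clutter n).sumIn A (fun i _ => ENNReal.ofReal (S.ic2RCS n i ω)) ω) ω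

end Sources

/-! ### Closed forms -/

namespace Params

variable (p : Params)

/-- Laplace transform of the LoS direct interference given the protection radius `Rd`. -/
def ltLoS (s Rd : ℝ) : ℝ≥0∞ :=
  expNeg (∫⁻ r in Set.Ioi Rd, ENNReal.ofReal
    (2 * Real.pi * p.lamBS * (1 / (p.M : ℝ) ^ 2) * p.pLOS r *
      (1 - (1 + s * p.Pc * p.Gm ^ 2 * p.CL * r ^ (-p.ηL) / p.mL) ^ (-p.mL)) * r))

/-- Laplace transform of the NLoS direct interference given the protection radius `Rd`. -/
def ltNLoS (s Rd : ℝ) : ℝ≥0∞ :=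
  expNeg (∫⁻ r in Set.Ioi Rd, ENNReal.ofReal
    (2 * Real.pi * p.lamBS * (1 / (p.M : ℝ) ^ 2) * (1 - p.pLOS r) *
      (1 - (1 + s * p.Pc * p.Gm ^ 2 * p.CN * r ^ (-p.ηN) / p.mN) ^ (-p.mN)) * r))

/-- Closed form of the Laplace transform of the aggregate direct interference. -/
def ltDirect (s : ℝ) : ℝ≥0∞ :=
  ∫⁻ Rd in Set.Ioi (0 : ℝ), p.ltLoS s Rd * p.ltNLoS s Rd *
    ENNReal.ofReal (2 * Real.pi * p.lamBS * Rd * Real.exp (-(Real.pi * p.lamBS * Rd ^ 2)))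

/-- Closed form of the intra-clutter effect. -/
def ltIntra (R₁ φ : ℝ) : ℝ≥0∞ :=
  ENNReal.ofReal (Real.exp (-(p.lamCl * (p.c * p.θB * R₁ / (2 * p.Wb)) *
    (φ * p.σcl / (p.σt + φ * p.σcl)))))

/-- Laplace transform of the inter-clutter interference reflected from the target, given the
protection radius `Ric` and the bistatic angle `β`. -/
def ltIC1 (s Ric β : ℝ) : ℝ≥0∞ :=
  expNeg (∫⁻ r in Set.Ioi Ric, ENNReal.ofReal
    (2 * Real.pi * p.lamBS * (1 / (p.M : ℝ)) * p.pLOS r *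
      (1 - 1 / (1 + s * Real.cos (β / 2) * r ^ (-p.ηL) * p.σt)) * r))

/-- Laplace transform of the inter-clutter interference reflected from scatterers, given the
protection radius `Ric` and the bistatic angle `β`. -/
def ltIC2 (R₁ s Ric β : ℝ) : ℝ≥0∞ :=
  expNeg (∫⁻ r in Set.Ioi Ric, ENNReal.ofReal
    (p.lamBS * (1 / (p.M : ℝ)) * p.pLOS r *
      (1 - Real.exp (-(p.lamCl * (p.c * p.θB * R₁ / (2 * p.Wb)) *
        (s * Real.cos (β / 2) * r ^ (-p.ηL) * p.σcl /
          (1 + s * Real.cos (β / 2) * r ^ (-p.ηL) * p.σcl))))) * (2 * Real.pi * r)))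

/-- Closed form of the Laplace transform of the inter-clutter interference. -/
def ltInter (R₁ s : ℝ) : ℝ≥0∞ :=
  ∫⁻ Ric in Set.Ioi R₁, ∫⁻ β in Set.Icc (0 : ℝ) Real.pi, p.ltIC1 s Ric β * p.ltIC2 R₁ s Ric β *
    ENNReal.ofReal (2 * p.lamBS * Ric *
      Real.exp (-(p.lamBS * Real.pi * (Ric ^ 2 - R₁ ^ 2))))

/-- Argument of the Laplace transform of the inter-clutter interference. -/
def sIC (R₁ φ : ℝ) : ℝ := φ * R₁ ^ p.ηL / p.σt

/-- Argument of the Laplace transform of the direct interference. -/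
def sD (R₁ φ : ℝ) : ℝ :=
  φ * (4 * Real.pi) ^ 3 * R₁ ^ (2 * p.ηL) / (p.Ps * p.Gm ^ 2 * p.wavelength ^ 2 * p.σt)

end Params

end

end ISAC

namespace ISAC

open Filter Topology

/-! ### The exponential on `[0, ∞]` -/

/-! The target RCS is exponential with mean `p.σt`. Multiplying the SINR inequality by a suitable
constant turns coverage into the event `J < targetRCS / p.σt`, where `J` is `s₂` times the
denominator (`lt_sinr_iff`). As `J` is independent of the target RCS, the exponential tail gives
coverage probability `E[exp(-J)]` (`measure_lt_targetRCS`). The scaled denominator is a sum of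
intra-clutter, inter-clutter, noise, direct and self-interference terms built from disjoint groups
of independent sources, so this Laplace transform is a product.

Every random factor is a shot noise of marked Poisson processes. The Laplace functional
`lintegral_expNeg_pointSum` follows from Poisson counts on the level sets of a simple function, by
monotone approximation. Averaging independent marks first replaces each weight by minus the
logarithm of the mark's Laplace transform, which gives `lintegral_expNeg_shotNoise`. The clutter
seen by one inter-clutter interferer is itself a shot noise, hence a mark to which the same lemma
applies once more. Two noises sharing a radius or an angle are only conditionally independent;
`lintegral_expNeg_pairShot` integrates the product of their transforms over the shared variables.
Polar coordinates (`lintegral_radial`) give the one-dimensional integrals.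

Everything is computed in `[0, ∞]` with `e^(-∞) = 0`, so neither the finiteness of the interference
nor the convergence of the radial integrals at infinity is needed. -/

@[simp] lemma expNeg_zero : expNeg 0 = 1 := by simp [expNeg]

@[simp] lemma expNeg_top : expNeg ⊤ = 0 := by simp [expNeg]

lemma expNeg_eq_inv (x : ℝ≥0∞) : expNeg x = (EReal.exp x)⁻¹ := by
  rw [expNeg, EReal.exp_neg]

/-- No finiteness is needed: the exponential of a nonnegative quantity is never `0`, so the product
of exponentials is never of the form `0 * ∞`. -/
lemma expNeg_add (x y : ℝ≥0∞) : expNeg (x + y) = expNeg x * expNeg y := by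
  rw [expNeg_eq_inv, expNeg_eq_inv, expNeg_eq_inv, EReal.coe_ennreal_add, EReal.exp_add,
    ENNReal.mul_inv]
  · left; simp
  · right
    simp

lemma expNeg_anti : Antitone expNeg := fun _ _ h =>
  EReal.exp_monotone (EReal.neg_le_neg_iff.2 (EReal.coe_ennreal_le_coe_ennreal_iff.2 h))

lemma expNeg_le_one (x : ℝ≥0∞) : expNeg x ≤ 1 := by
  simpa using expNeg_anti (zero_le (a := x))

lemma continuous_expNeg : Continuous expNeg := by
  unfold expNeg
  exact EReal.expHomeomorph.continuous.comp (continuous_neg.comp continuous_coe_ennreal_ereal)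

@[fun_prop]
lemma measurable_expNeg : Measurable expNeg := continuous_expNeg.measurable

lemma expNeg_ofReal {x : ℝ} (hx : 0 ≤ x) :
    expNeg (ENNReal.ofReal x) = ENNReal.ofReal (Real.exp (-x)) := by
  rw [expNeg, EReal.coe_ennreal_ofReal, max_eq_left hx, ← EReal.coe_neg, EReal.exp_coe]

lemma expNeg_sum {ι : Type*} (s : Finset ι) (f : ι → ℝ≥0∞) :
    expNeg (∑ i ∈ s, f i) = ∏ i ∈ s, expNeg (f i) := by
  classical
  induction s using Finset.induction_on with
  | empty => simp
  | insert a s ha ih => rw [Finset.sum_insert ha, Finset.prod_insert ha, expNeg_add, ih]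

lemma expNeg_mul_natCast (c : ℝ≥0∞) (n : ℕ) : expNeg (c * n) = expNeg c ^ n := by
  induction n with
  | zero => simp
  | succ n ih => rw [Nat.cast_succ, mul_add, mul_one, expNeg_add, ih, pow_succ]

lemma tendsto_prod_expNeg (f : ℕ → ℝ≥0∞) :
    Tendsto (fun n => ∏ i ∈ Finset.range n, expNeg (f i)) atTop (𝓝 (expNeg (∑' i, f i))) := by
  simp_rw [← expNeg_sum]
  exact (continuous_expNeg.tendsto _).comp ENNReal.summable.hasSum.tendsto_sum_nat

/-- The inverse of `expNeg` on `[0, 1]`. -/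
noncomputable def negLog (y : ℝ≥0∞) : ℝ≥0∞ := (-ENNReal.log y).toENNReal

lemma expNeg_negLog {y : ℝ≥0∞} (hy : y ≤ 1) : expNeg (negLog y) = y := by
  rw [expNeg, negLog, EReal.coe_toENNReal, neg_neg, ENNReal.exp_log]
  rw [EReal.neg_nonneg]
  simpa using hy

@[fun_prop]
lemma measurable_negLog : Measurable negLog := by
  unfold negLog
  fun_prop

/-! ### Sums over the points of a configuration -/

variable {Ω E : Type*}

/-- The sum of `f i x` over the points `x` (with index `i`) of a configuration, given by the
number and the enumeration of its points. -/
noncomputable def pointSum (c : ℕ∞ × (ℕ → E)) (f : ℕ → E → ℝ≥0∞) : ℝ≥0∞ :=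
  ∑' i : ℕ, {n : ℕ∞ | (i : ℕ∞) < n}.indicator (fun _ => f i (c.2 i)) c.1

/-- The configuration of points as a random element. -/
def PointProcess.cfg (Φ : PointProcess Ω E) (ω : Ω) : ℕ∞ × (ℕ → E) :=
  (Φ.count ω, fun i => Φ.pt i ω)

/-- Replaces a sum over a random index set by a fixed function of the configuration, to which
measurability and independence arguments apply. -/
lemma PointProcess.sumIn_eq_pointSum (Φ : PointProcess Ω E) (B : Set E) (f : ℕ → E → ℝ≥0∞)
    (ω : Ω) : Φ.sumIn B f ω = pointSum (Φ.cfg ω) (fun i => B.indicator (f i)) := by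
  classical
  rw [PointProcess.sumIn, pointSum, tsum_subtype (Φ.idx B ω) (fun i => f i (Φ.pt i ω))]
  refine tsum_congr fun i => ?_
  by_cases h1 : (i : ℕ∞) < Φ.count ω <;> by_cases h2 : Φ.pt i ω ∈ B <;>
    simp [PointProcess.cfg, PointProcess.idx, Set.indicator, h1, h2]

lemma PointProcess.numIn_eq_pointSum (Φ : PointProcess Ω E) (B : Set E) (ω : Ω) :
    (Φ.numIn B ω : ℝ≥0∞) = pointSum (Φ.cfg ω) (fun _ => B.indicator 1) := by
  rw [← Φ.sumIn_eq_pointSum B (fun _ => 1)]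
  simp [PointProcess.numIn, PointProcess.sumIn]

lemma pointSum_const_mul (c : ℕ∞ × (ℕ → E)) (a : ℝ≥0∞) (f : ℕ → E → ℝ≥0∞) :
    a * pointSum c f = pointSum c (fun i x => a * f i x) := by
  rw [pointSum, pointSum, ← ENNReal.tsum_mul_left]
  refine tsum_congr fun i => ?_
  simp only [Set.indicator]
  split_ifs <;> simp

lemma pointSum_finsetSum {ι : Type*} (s : Finset ι) (c : ℕ∞ × (ℕ → E))
    (f : ι → ℕ → E → ℝ≥0∞) :
    pointSum c (fun i x => ∑ j ∈ s, f j i x) = ∑ j ∈ s, pointSum c (f j) := by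
  simp only [pointSum]
  rw [← Summable.tsum_finsetSum (fun _ _ => ENNReal.summable)]
  refine tsum_congr fun i => ?_
  simp only [Set.indicator]
  split_ifs <;> simp

/-- A sum over `ℕ` is an integral for the counting measure, so monotone convergence applies. -/
lemma tendsto_pointSum (c : ℕ∞ × (ℕ → E)) (f : ℕ → ℕ → E → ℝ≥0∞) (g : ℕ → E → ℝ≥0∞)
    (hmono : ∀ i x, Monotone fun n => f n i x)
    (hlim : ∀ i x, Tendsto (fun n => f n i x) atTop (𝓝 (g i x))) :
    Tendsto (fun n => pointSum c (f n)) atTop (𝓝 (pointSum c g)) := by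
  simp only [pointSum, ← lintegral_count]
  refine lintegral_tendsto_of_tendsto_of_monotone (fun _ => Measurable.of_discrete.aemeasurable) ?_ ?_
  · refine ae_of_all _ fun i m n hmn => ?_
    simp only [Set.indicator]
    split_ifs
    · exact hmono _ _ hmn
    · exact le_rfl
  · refine ae_of_all _ fun i => ?_
    simp only [Set.indicator]
    split_ifs
    · exact hlim _ _
    · exact tendsto_const_nhds

section Measurability

variable {α : Type*} {mα : MeasurableSpace α} [MeasurableSpace E]

lemma measurable_pointSum {c : α → ℕ∞ × (ℕ → E)} (hc : Measurable c)
    {f : α → ℕ → E → ℝ≥0∞} (hf : ∀ i, Measurable fun q : α × E => f q.1 i q.2) :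
    Measurable fun a => pointSum (c a) (f a) := by
  unfold pointSum
  refine Measurable.tsum fun i => ?_
  have h1 : Measurable fun a => f a i ((c a).2 i) :=
    (hf i).comp (measurable_id.prodMk ((measurable_pi_apply i).comp (measurable_snd.comp hc)))
  exact Measurable.ite (p := fun a => (i : ℕ∞) < (c a).1)
    ((measurable_fst.comp hc) (.of_discrete : MeasurableSet {n : ℕ∞ | (i : ℕ∞) < n})) h1
    measurable_const

end Measurability

end ISAC

namespace ISAC

open Filter Topology

/-! ### Independence -/

section Independence

variable {Ω α β : Type*} {mΩ : MeasurableSpace Ω} [MeasurableSpace α] [MeasurableSpace β]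
  {μ : Measure Ω}

/-- Fubini for the product law: `U` is frozen while `V` is averaged. This replaces conditional
expectations throughout. -/
lemma lintegral_comp_of_indepFun [IsProbabilityMeasure μ] {U : Ω → α} {V : Ω → β} (hU : Measurable U) (hV : Measurable V)
    (h : IndepFun U V μ) {F : α × β → ℝ≥0∞} (hF : Measurable F) :
    ∫⁻ ω, F (U ω, V ω) ∂μ = ∫⁻ u, ∫⁻ ω, F (u, V ω) ∂μ ∂(μ.map U) := by
  rw [← lintegral_map (f := F) hF (hU.prodMk hV),
    (indepFun_iff_map_prod_eq_prod_map_map hU.aemeasurable hV.aemeasurable).1 h]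
  have := Measure.isProbabilityMeasure_map (μ := μ) hU.aemeasurable
  have := Measure.isProbabilityMeasure_map (μ := μ) hV.aemeasurable
  rw [lintegral_prod _ hF.aemeasurable]
  refine lintegral_congr fun u => ?_
  rw [lintegral_map (f := fun v => F (u, v)) (by fun_prop) hV]

lemma indepFun_of_measurable_iSup {ι : Type*} {m : ι → MeasurableSpace Ω} (hm : ∀ i, m i ≤ mΩ)
    (h : iIndep m μ) {S T : Set ι} (hST : Disjoint S T) {f : Ω → α} {g : Ω → β}
    (hf : Measurable[⨆ i ∈ S, m i] f) (hg : Measurable[⨆ i ∈ T, m i] g) : IndepFun f g μ := by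
  rw [IndepFun_iff_Indep]
  exact indep_of_indep_of_le_left (indep_of_indep_of_le_right
    (indep_iSup_of_disjoint hm h hST) hg.comap_le) hf.comap_le

/-- Induction on finite subfamilies: one block of sources is split off from the union of the
remaining blocks. -/
lemma iIndepFun_of_measurable_iSup [IsProbabilityMeasure μ] {ι κ : Type*} {m : ι → MeasurableSpace Ω}
    (hm : ∀ i, m i ≤ mΩ) (h : iIndep m μ) {T : κ → Set ι}
    (hT : Pairwise fun j k => Disjoint (T j) (T k)) {f : κ → Ω → α}
    (hf : ∀ k, Measurable[⨆ i ∈ T k, m i] (f k)) : iIndepFun f μ := by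
  classical
  rw [iIndepFun_iff_measure_inter_preimage_eq_mul]
  intro s A hA
  induction s using Finset.induction_on with
  | empty => simp
  | insert a s ha ih =>
    rw [Finset.prod_insert ha, Finset.set_biInter_insert,
      ← ih fun i hi => hA i (Finset.mem_insert_of_mem hi)]
    have hd : Disjoint (T a) (⋃ k ∈ s, T k) := by
      simp only [Set.disjoint_iUnion_right]
      exact fun k hk => hT (by rintro rfl; exact ha hk)
    refine (Indep_iff _ _ μ).1 (indep_iSup_of_disjoint hm h hd) _ _
      (hf a (hA a (Finset.mem_insert_self a s))) ?_
    refine Finset.measurableSet_biInter s fun k hk => ?_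
    have hle : ⨆ i ∈ T k, m i ≤ ⨆ i ∈ ⋃ k ∈ s, T k, m i :=
      biSup_mono fun i hi => Set.mem_biUnion hk hi
    exact hle _ (hf k (hA k (Finset.mem_insert_of_mem hk)))

/-- Finite products factor by independence and are bounded by `1`, so dominated convergence passes
to the infinite sum. Writing the individual transforms as `expNeg (a i)` turns the infinite product
into a series. -/
lemma lintegral_expNeg_tsum [IsProbabilityMeasure μ] {Y : ℕ → Ω → ℝ≥0∞} (hY : ∀ i, Measurable (Y i)) (h : iIndepFun Y μ)
    {a : ℕ → ℝ≥0∞} (ha : ∀ i, ∫⁻ ω, expNeg (Y i ω) ∂μ = expNeg (a i)) :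
    ∫⁻ ω, expNeg (∑' i, Y i ω) ∂μ = expNeg (∑' i, a i) := by
  refine tendsto_nhds_unique (f := fun n => ∫⁻ ω, ∏ i ∈ Finset.range n, expNeg (Y i ω) ∂μ)
    (l := atTop) ?_ ?_
  · refine tendsto_lintegral_of_dominated_convergence 1 (fun n => ?_) (fun n => ?_) (by simp) ?_
    · exact Finset.measurable_fun_prod _ fun i _ => measurable_expNeg.comp (hY i)
    · exact ae_of_all _ fun ω => Finset.prod_le_one' fun i _ => expNeg_le_one _
    · exact ae_of_all _ fun ω => tendsto_prod_expNeg _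
  · have : ∀ n, ∫⁻ ω, ∏ i ∈ Finset.range n, expNeg (Y i ω) ∂μ
        = ∏ i ∈ Finset.range n, expNeg (a i) := fun n => by
      rw [lintegral_prod_eq_prod_lintegral_of_indepFun (Finset.range n)
        (fun i ω => expNeg (Y i ω)) (h.comp (fun _ => expNeg) fun _ => measurable_expNeg)
        fun i => measurable_expNeg.comp (hY i)]
      exact Finset.prod_congr rfl fun i _ => ha i
    simp_rw [this]
    exact tendsto_prod_expNeg a

end Independence

/-! ### The Laplace functional of a Poisson point process -/

lemma lintegral_expNeg_poissonMeasure (r : NNReal) (c : ℝ≥0∞) :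
    ∫⁻ n : ℕ, expNeg (c * n) ∂(poissonMeasure r) = expNeg (r * (1 - expNeg c)) := by
  obtain ⟨q, hq⟩ : ∃ q : NNReal, expNeg c = q :=
    ⟨_, (ENNReal.coe_toNNReal (ne_top_of_le_ne_top ENNReal.one_ne_top (expNeg_le_one c))).symm⟩
  have hq1 : (q : ℝ) ≤ 1 := by
    have := hq ▸ expNeg_le_one c
    exact_mod_cast this
  have h1 : (r : ℝ≥0∞) * (1 - expNeg c) = ENNReal.ofReal (r * (1 - q)) := by
    rw [hq, ENNReal.ofReal_mul r.coe_nonneg, ENNReal.ofReal_sub _ q.coe_nonneg]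
    simp
  rw [h1, expNeg_ofReal (mul_nonneg r.coe_nonneg (by linarith)), lintegral_countable']
  -- Exponential tilting: weighting the Poisson law of mean `r` by `q ^ n` gives `e^(-r(1-q))` times
  -- the Poisson law of mean `r * q`, whose total mass is `1`.
  have h2 : ∀ n : ℕ, expNeg (c * n) * poissonMeasure r {n}
      = ENNReal.ofReal (Real.exp (-(r * (1 - q)))) * poissonMeasure (r * q) {n} := fun n => by
    rw [expNeg_mul_natCast, hq, poissonMeasure_singleton, poissonMeasure_singleton,
      ← ENNReal.ofReal_mul (Real.exp_pos _).le, ← ENNReal.ofReal_coe_nnreal,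
      ← ENNReal.ofReal_pow q.coe_nonneg, ← ENNReal.ofReal_mul (by positivity)]
    congr 1
    have : Real.exp (-(r : ℝ)) = Real.exp (-(r * (1 - q))) * Real.exp (-(r * q : ℝ)) := by
      rw [← Real.exp_add]; ring_nf
    push_cast
    rw [this]
    ring
  simp_rw [h2]
  rw [ENNReal.tsum_mul_left]
  have h3 := lintegral_countable' (μ := poissonMeasure (r * q)) (fun _ => 1)
  simp only [lintegral_one, measure_univ, one_mul] at h3
  rw [← h3, mul_one]

namespace PointProcess

variable {Ω E : Type*} [MeasurableSpace Ω] [MeasurableSpace E] {Φ : PointProcess Ω E}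
  {Λ : Measure E} {μ : Measure Ω}

namespace IsPoisson

lemma measurable_cfg (h : Φ.IsPoisson Λ μ) : Measurable Φ.cfg :=
  h.measurable_count.prodMk (measurable_pi_lambda _ h.measurable_pt)

lemma measurable_numIn (h : Φ.IsPoisson Λ μ) {B : Set E} (hB : MeasurableSet B) :
    Measurable fun ω => (Φ.numIn B ω : ℝ≥0∞) := by
  simp_rw [Φ.numIn_eq_pointSum]
  exact measurable_pointSum h.measurable_cfg fun i =>
    (measurable_one.indicator hB).comp measurable_snd

lemma lintegral_expNeg_numIn (h : Φ.IsPoisson Λ μ) {B : Set E} (hB : MeasurableSet B)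
    (hfin : Λ B ≠ ⊤) (c : ℝ≥0∞) :
    ∫⁻ ω, expNeg (c * (Φ.numIn B ω : ℝ≥0∞)) ∂μ = expNeg (Λ B * (1 - expNeg c)) := by
  have hm : Measurable fun n : ℕ∞ => expNeg (c * (n : ℝ≥0∞)) := .of_discrete
  have hl := h.hasLaw_numIn B hB hfin
  rw [← lintegral_map' (f := fun n : ℕ∞ => expNeg (c * (n : ℝ≥0∞))) hm.aemeasurable
    hl.aemeasurable, hl.map_eq, lintegral_map hm .of_discrete]
  simp only [ENat.toENNReal_coe]
  rw [lintegral_expNeg_poissonMeasure, ENNReal.coe_toNNReal hfin]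

lemma lintegral_expNeg_sum_numIn (h : Φ.IsPoisson Λ μ) {n : ℕ} {B : Fin n → Set E}
    (hB : ∀ j, MeasurableSet (B j)) (hfin : ∀ j, Λ (B j) ≠ ⊤)
    (hd : Pairwise fun j k => Disjoint (B j) (B k)) (c : Fin n → ℝ≥0∞) :
    ∫⁻ ω, expNeg (∑ j, c j * (Φ.numIn (B j) ω : ℝ≥0∞)) ∂μ
      = expNeg (∑ j, Λ (B j) * (1 - expNeg (c j))) := by
  simp_rw [expNeg_sum]
  have hi := (h.indep_numIn n B hB hd).comp (fun j (k : ℕ∞) => expNeg (c j * (k : ℝ≥0∞)))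
    fun _ => .of_discrete
  rw [lintegral_prod_eq_prod_lintegral_of_indepFun Finset.univ
    (fun j ω => expNeg (c j * (Φ.numIn (B j) ω : ℝ≥0∞))) hi
    fun j => measurable_expNeg.comp ((h.measurable_numIn (hB j)).const_mul _)]
  exact Finset.prod_congr rfl fun j _ => h.lintegral_expNeg_numIn (hB j) (hfin j) _

lemma lintegral_expNeg_simpleFunc (h : Φ.IsPoisson Λ μ) (f : SimpleFunc E ℝ≥0∞)
    (hf : Λ (Function.support f) ≠ ⊤) :
    ∫⁻ ω, expNeg (pointSum (Φ.cfg ω) fun _ => f) ∂μ = expNeg (∫⁻ x, 1 - expNeg (f x) ∂Λ) := by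
  classical
  -- The value `0` is discarded because its level set may have infinite intensity; it contributes
  -- nothing to either side.
  set t : Finset ℝ≥0∞ := f.range.erase 0
  let e := t.equivFin.symm
  let c : Fin t.card → ℝ≥0∞ := fun j => e j
  let B : Fin t.card → Set E := fun j => f ⁻¹' {c j}
  have hB : ∀ j, MeasurableSet (B j) := fun j => f.measurableSet_fiber _
  have hc : ∀ j, c j ≠ 0 := fun j => (Finset.mem_erase.1 (e j).2).1
  have hfin : ∀ j, Λ (B j) ≠ ⊤ := fun j =>
    ne_top_of_le_ne_top hf (measure_mono fun x hx => by
      rw [Function.mem_support, show f x = c j from hx]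
      exact hc j)
  have hd : Pairwise fun j k => Disjoint (B j) (B k) := fun j k hjk =>
    Disjoint.preimage _ (by
      rw [Set.disjoint_singleton]
      exact fun hh => hjk (e.injective (Subtype.ext hh)))
  -- Used twice: with the identity for the sum over points, and with `1 - expNeg` for the intensity
  -- integral.
  have key : ∀ (g : ℝ≥0∞ → ℝ≥0∞), g 0 = 0 → ∀ x,
      g (f x) = ∑ j, g (c j) * (B j).indicator 1 x := fun g hg x => by
    by_cases hx : f x = 0
    · rw [hx, hg, eq_comm]
      refine Finset.sum_eq_zero fun j _ => ?_
      have : x ∉ B j := fun hh => hc j (by rw [← hx]; exact (show f x = c j from hh).symm)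
      simp [this]
    · have hmem : f x ∈ t := Finset.mem_erase.2 ⟨hx, f.mem_range_self x⟩
      have hcj : c (e.symm ⟨f x, hmem⟩) = f x := by simp [c]
      rw [Finset.sum_eq_single (e.symm ⟨f x, hmem⟩)]
      · rw [Set.indicator_of_mem (show x ∈ B _ from hcj.symm), hcj]
        simp
      · intro j _ hj
        have : x ∉ B j := fun hh => hj (by
          rw [Equiv.eq_symm_apply]
          exact Subtype.ext (show f x = c j from hh).symm)
        simp [this]
      · simp
  have h1 : ∀ ω, pointSum (Φ.cfg ω) (fun _ => f) = ∑ j, c j * (Φ.numIn (B j) ω : ℝ≥0∞) := by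
    intro ω
    simp_rw [Φ.numIn_eq_pointSum, pointSum_const_mul, ← pointSum_finsetSum]
    congr with i x
    exact key id rfl x
  have h2 : ∫⁻ x, 1 - expNeg (f x) ∂Λ = ∑ j, Λ (B j) * (1 - expNeg (c j)) := by
    simp_rw [fun x => key (fun y => 1 - expNeg y) (by simp) x]
    rw [lintegral_finsetSum _ fun j _ => (measurable_one.indicator (hB j)).const_mul _]
    refine Finset.sum_congr rfl fun j _ => ?_
    rw [lintegral_const_mul _ (measurable_one.indicator (hB j)), lintegral_indicator_one (hB j),
      mul_comm]
  simp_rw [h1, h2]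
  exact h.lintegral_expNeg_sum_numIn hB hfin hd c

/-- The Laplace functional of a Poisson point process. -/
lemma lintegral_expNeg_pointSum [IsProbabilityMeasure μ] [SigmaFinite Λ] (h : Φ.IsPoisson Λ μ) {f : E → ℝ≥0∞}
    (hf : Measurable f) :
    ∫⁻ ω, expNeg (pointSum (Φ.cfg ω) fun _ => f) ∂μ = expNeg (∫⁻ x, 1 - expNeg (f x) ∂Λ) := by
  -- Truncating to the spanning sets makes the supports of finite intensity while the approximation
  -- stays increasing.
  let g : ℕ → SimpleFunc E ℝ≥0∞ := fun n => (SimpleFunc.eapprox f n).restrict (spanningSets Λ n)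
  have hg : ∀ n x, g n x = (spanningSets Λ n).indicator (SimpleFunc.eapprox f n) x := fun n x =>
    SimpleFunc.restrict_apply _ (measurableSet_spanningSets Λ n) x
  have hmono : ∀ x, Monotone fun n => g n x := fun x m n hmn => by
    simp only [hg]
    exact (Set.indicator_le_indicator_of_subset (monotone_spanningSets Λ hmn)
      (fun _ => zero_le) x).trans
      (Set.indicator_le_indicator (SimpleFunc.monotone_eapprox f hmn x))
  have hlim : ∀ x, Tendsto (fun n => g n x) atTop (𝓝 (f x)) := fun x => by
    refine (SimpleFunc.tendsto_eapprox hf x).congr' ?_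
    obtain ⟨k, hk⟩ := Set.mem_iUnion.1
      ((iUnion_spanningSets Λ).symm ▸ Set.mem_univ x : x ∈ ⋃ i, spanningSets Λ i)
    filter_upwards [eventually_ge_atTop k] with n hn
    rw [hg, Set.indicator_of_mem (monotone_spanningSets Λ hn hk)]
  have hfin : ∀ n, Λ (Function.support (g n)) ≠ ⊤ := fun n =>
    ne_top_of_le_ne_top (measure_spanningSets_lt_top Λ n).ne (measure_mono fun x hx => by
      by_contra hxn
      exact hx (by rw [hg, Set.indicator_of_notMem hxn]))
  refine tendsto_nhds_unique
    (f := fun n => ∫⁻ ω, expNeg (pointSum (Φ.cfg ω) fun _ => g n) ∂μ) (l := atTop) ?_ ?_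
  · refine tendsto_lintegral_of_dominated_convergence 1 (fun n => ?_) (fun n => ?_) (by simp) ?_
    · exact measurable_expNeg.comp (measurable_pointSum h.measurable_cfg fun i =>
        (g n).measurable.comp measurable_snd)
    · exact ae_of_all _ fun ω => expNeg_le_one _
    · exact ae_of_all _ fun ω => (continuous_expNeg.tendsto _).comp
        (tendsto_pointSum _ _ _ (fun _ x => hmono x) fun _ x => hlim x)
  · simp_rw [h.lintegral_expNeg_simpleFunc (g _) (hfin _)]
    -- The limit integral may be infinite, so monotone convergence is used here: `1 - expNeg (g n
    -- x)` increases with `n`.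
    refine (continuous_expNeg.tendsto _).comp (lintegral_tendsto_of_tendsto_of_monotone
      (fun n => (measurable_const.sub (measurable_expNeg.comp (g n).measurable)).aemeasurable)
      (ae_of_all _ fun x m n hmn => ?_) (ae_of_all _ fun x => ?_))
    · exact tsub_le_tsub_left (expNeg_anti (hmono x hmn)) 1
    · exact ENNReal.Tendsto.sub tendsto_const_nhds ((continuous_expNeg.tendsto _).comp (hlim x))
        (Or.inl ENNReal.one_ne_top)

end IsPoisson

/-- A Poisson point process with intensity measure `Λ`, whose points carry independent identically
distributed marks with Laplace transform `ψ`. -/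
structure IsMarkedPoisson (Φ : PointProcess Ω E) (Y : ℕ → Ω → ℝ≥0∞) (Λ : Measure E)
    (ψ : ℝ≥0∞ → ℝ≥0∞) (μ : Measure Ω) : Prop where
  isPoisson : Φ.IsPoisson Λ μ
  measurable_mark : ∀ i, Measurable (Y i)
  iIndepFun_mark : iIndepFun Y μ
  indepFun : IndepFun Φ.cfg (fun ω i => Y i ω) μ
  measurable_laplace : Measurable ψ
  laplace_mark : ∀ i s, ∫⁻ ω, expNeg (s * Y i ω) ∂μ = ψ s

namespace IsMarkedPoisson

variable {Y : ℕ → Ω → ℝ≥0∞} {ψ : ℝ≥0∞ → ℝ≥0∞}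

lemma laplace_zero [IsProbabilityMeasure μ] (h : Φ.IsMarkedPoisson Y Λ ψ μ) : ψ 0 = 1 := by
  simp [← h.laplace_mark 0]

lemma measurable_marks (h : Φ.IsMarkedPoisson Y Λ ψ μ) : Measurable fun ω i => Y i ω :=
  measurable_pi_lambda _ h.measurable_mark

/-- The Laplace transform of a shot noise. -/
lemma lintegral_expNeg_shotNoise [IsProbabilityMeasure μ] [SigmaFinite Λ]
    (h : Φ.IsMarkedPoisson Y Λ ψ μ) {g : E → ℝ≥0∞} (hg : Measurable g) :
    ∫⁻ ω, expNeg (pointSum (Φ.cfg ω) fun i x => g x * Y i ω) ∂μ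
      = expNeg (∫⁻ x, 1 - ψ (g x) ∂Λ) := by
  obtain ⟨h, hY, hYi, hind, hψm, hψ⟩ := h
  have hψ1 : ∀ s, ψ s ≤ 1 := fun s => by
    rw [← hψ 0 s]
    exact (lintegral_mono fun ω => expNeg_le_one _).trans (by simp)
  have hψ0 : ψ 0 = 1 := by simp [← hψ 0]
  let F : (ℕ∞ × (ℕ → E)) × (ℕ → ℝ≥0∞) → ℝ≥0∞ := fun q =>
    expNeg (pointSum q.1 fun i x => g x * q.2 i)
  have hF : Measurable F := measurable_expNeg.comp (measurable_pointSum measurable_fst fun i => by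
    fun_prop)
  have hYm : Measurable fun ω i => Y i ω := measurable_pi_lambda _ hY
  -- For a frozen configuration the marks average to the product of `ψ (g x)` over its points.
  -- Through `negLog` this is `expNeg` of an unmarked sum, ready for the Laplace functional.
  have inner : ∀ c : ℕ∞ × (ℕ → E), ∫⁻ ω, F (c, fun i => Y i ω) ∂μ
      = expNeg (pointSum c fun _ x => negLog (ψ (g x))) := fun c => by
    simp only [F, pointSum]
    -- Indices beyond the number of points get weight `0`, hence the harmless factor `ψ 0 = 1`.
    let b : ℕ → ℝ≥0∞ := fun i => {n : ℕ∞ | (i : ℕ∞) < n}.indicator (fun _ => g (c.2 i)) c.1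
    have hb : ∀ (i : ℕ) y, {n : ℕ∞ | (i : ℕ∞) < n}.indicator (fun _ => g (c.2 i) * y) c.1
        = b i * y := fun i y => by
      simp only [b, Set.indicator]
      split_ifs <;> simp
    simp_rw [hb]
    refine lintegral_expNeg_tsum (fun i => (hY i).const_mul _)
      (hYi.comp (fun i y => b i * y) fun i => measurable_id.const_mul _) fun i => ?_
    rw [hψ]
    simp only [b, Set.indicator]
    split_ifs
    · rw [expNeg_negLog (hψ1 _)]
    · simp [hψ0]
  have := lintegral_comp_of_indepFun h.measurable_cfg hYm hind hF
  simp only [F] at this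
  rw [this]
  change ∫⁻ c, ∫⁻ ω, F (c, fun i => Y i ω) ∂μ ∂(μ.map Φ.cfg) = _
  simp_rw [inner]
  have hn : Measurable fun x => negLog (ψ (g x)) := measurable_negLog.comp (hψm.comp hg)
  rw [lintegral_map (f := fun c : ℕ∞ × (ℕ → E) => expNeg (pointSum c fun _ x => negLog (ψ (g x))))
    (measurable_expNeg.comp (measurable_pointSum measurable_id fun i => hn.comp measurable_snd))
    h.measurable_cfg, h.lintegral_expNeg_pointSum hn]
  simp_rw [expNeg_negLog (hψ1 _)]

end IsMarkedPoisson

end PointProcess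

end ISAC

namespace ISAC

open Set

/-! ### Laplace transforms of the marks -/

/-- The Laplace transform of the positive part of a real random variable with law `ν`. -/
noncomputable def laplace (ν : Measure ℝ) (s : ℝ≥0∞) : ℝ≥0∞ :=
  ∫⁻ x, expNeg (s * ENNReal.ofReal x) ∂ν

@[fun_prop]
lemma measurable_laplace (ν : Measure ℝ) [SFinite ν] : Measurable (laplace ν) :=
  Measurable.lintegral_prod_right' (f := fun q : ℝ≥0∞ × ℝ => expNeg (q.1 * ENNReal.ofReal q.2))
    (by fun_prop)

lemma laplace_zero (ν : Measure ℝ) [IsProbabilityMeasure ν] : laplace ν 0 = 1 := by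
  simp [laplace]

lemma measurable_gammaPDF (a r : ℝ) : Measurable (gammaPDF a r) :=
  (measurable_gammaPDFReal a r).ennreal_ofReal

lemma laplace_gammaMeasure {a r s : ℝ} (ha : 0 < a) (hr : 0 < r) (hs : 0 ≤ s) :
    laplace (gammaMeasure a r) (ENNReal.ofReal s) = ENNReal.ofReal ((1 + s / r) ^ (-a)) := by
  have hrs : 0 < r + s := by linarith
  rw [laplace, gammaMeasure, lintegral_withDensity_eq_lintegral_mul _
    (measurable_gammaPDF a r) (by fun_prop)]
  -- Tilting again: multiplying the Gamma density of rate `r` by `e^(-s x)` gives a constant times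
  -- the Gamma density of rate `r + s`.
  have key : ∀ x, (gammaPDF a r * fun x => expNeg (ENNReal.ofReal s * ENNReal.ofReal x)) x
      = ENNReal.ofReal ((1 + s / r) ^ (-a)) * gammaPDF a (r + s) x := fun x => by
    rw [Pi.mul_apply]
    rcases lt_or_ge x 0 with hx | hx
    · simp [gammaPDF_of_neg hx]
    · rw [gammaPDF_of_nonneg hx, gammaPDF_of_nonneg hx, ← ENNReal.ofReal_mul hs,
        expNeg_ofReal (mul_nonneg hs hx), ← ENNReal.ofReal_mul (by positivity),
        ← ENNReal.ofReal_mul (by positivity)]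
      congr 1
      have h1 : 1 + s / r = (r + s) / r := by field_simp
      have h2 : Real.exp (-((r + s) * x)) = Real.exp (-(r * x)) * Real.exp (-(s * x)) := by
        rw [← Real.exp_add]; ring_nf
      rw [h1, Real.rpow_neg (by positivity), Real.div_rpow hrs.le hr.le, h2]
      have : (r + s) ^ a ≠ 0 := (Real.rpow_pos_of_pos hrs a).ne'
      field_simp
  simp_rw [key]
  rw [lintegral_const_mul _ (measurable_gammaPDF a (r + s)),
    lintegral_gammaPDF_eq_one ha hrs, mul_one]

lemma laplace_expMeasure {σ s : ℝ} (hσ : 0 < σ) (hs : 0 ≤ s) :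
    laplace (expMeasure (1 / σ)) (ENNReal.ofReal s) = ENNReal.ofReal (1 / (1 + s * σ)) := by
  rw [expMeasure, laplace_gammaMeasure one_pos (by positivity) hs, Real.rpow_neg_one]
  congr 1
  field_simp

/-- The exponential tail, allowing `d = ∞`, where both sides vanish. It is the source of every
Laplace transform in the coverage formula. -/
lemma expMeasure_lt_ofReal {r K : ℝ} (hr : 0 < r) (hK : 0 < K) (d : ℝ≥0∞) :
    expMeasure r {x | d < ENNReal.ofReal (K * x)} = expNeg (ENNReal.ofReal (r / K) * d) := by
  have := isProbabilityMeasure_expMeasure hr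
  rcases eq_or_ne d ⊤ with rfl | hd
  · rw [ENNReal.mul_top (by simpa using div_pos hr hK)]
    simp
  · obtain ⟨t, ht, rfl⟩ : ∃ t : ℝ, 0 ≤ t ∧ d = ENNReal.ofReal t :=
      ⟨d.toReal, ENNReal.toReal_nonneg, (ENNReal.ofReal_toReal hd).symm⟩
    have hset : {x | ENNReal.ofReal t < ENNReal.ofReal (K * x)} = (Iic (t / K))ᶜ := by
      ext x
      rw [mem_ofPred_eq, ENNReal.ofReal_lt_ofReal_iff_of_nonneg ht, mem_compl_iff, mem_Iic, not_le,
        div_lt_iff₀ hK, mul_comm]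
    have htK : 0 ≤ t / K := by positivity
    rw [hset, prob_compl_eq_one_sub measurableSet_Iic, ← ENNReal.ofReal_mul (by positivity),
      expNeg_ofReal (by positivity), ← ofReal_cdf, cdf_expMeasure_eq hr, if_pos htK,
      ← ENNReal.ofReal_one, ← ENNReal.ofReal_sub]
    · congr 1
      rw [sub_sub_cancel]
      congr 2
      field_simp
    · rw [sub_nonneg, Real.exp_le_one_iff]
      have := mul_nonneg hr.le htK
      linarith

/-! ### Polar coordinates in the plane -/

lemma lintegral_fun_norm_plane {f : ℝ → ℝ≥0∞} (hf : Measurable f) :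
    ∫⁻ x : Plane, f ‖x‖ = ∫⁻ r in Ioi (0 : ℝ), f r * ENNReal.ofReal (2 * Real.pi * r) := by
  have hm : Measurable fun x : Ioi (0 : ℝ) => f x := by fun_prop
  calc
    ∫⁻ x : Plane, f ‖x‖ = ∫⁻ x : ({(0)}ᶜ : Set Plane), f ‖x.1‖ ∂(volume.comap Subtype.val) := by
      rw [lintegral_subtype_comap (measurableSet_singleton _).compl fun x => f ‖x‖,
        restrict_compl_singleton]
    _ = ∫⁻ x, f x.2 ∂((volume : Measure Plane).toSphere.prod (Measure.volumeIoiPow 1)) := by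
      have := (volume : Measure Plane).measurePreserving_homeomorphUnitSphereProd
      rw [finrank_euclideanSpace_fin] at this
      rw [← this.lintegral_comp (by fun_prop)]
      simp
    _ = (∫⁻ x, f x ∂(Measure.volumeIoiPow 1)) * (volume : Measure Plane).toSphere univ := by
      rw [lintegral_prod _ (by fun_prop)]
      simp
    _ = _ := by
      -- The unit circle has mass dimension times area of the unit disc, that is `2π`; the radial
      -- measure supplies the factor `r`.
      rw [Measure.toSphere_apply_univ, Measure.volumeIoiPow,
        lintegral_withDensity_eq_lintegral_mul _ (by fun_prop) hm,
        finrank_euclideanSpace_fin, EuclideanSpace.volume_ball_fin_two]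
      simp only [Pi.mul_apply, pow_one]
      rw [lintegral_subtype_comap measurableSet_Ioi fun r => ENNReal.ofReal r * f r,
        ← lintegral_mul_const _ (by fun_prop)]
      refine setLIntegral_congr_fun measurableSet_Ioi fun r (hr : 0 < r) => ?_
      have h2 : (2 : ℝ≥0∞) = ENNReal.ofReal 2 := by simp
      rw [mul_assoc 2 Real.pi r, ENNReal.ofReal_mul two_pos.le, ENNReal.ofReal_mul Real.pi_pos.le]
      simp only [Nat.cast_ofNat, ENNReal.ofReal_one, one_pow, one_mul, h2]
      ring

/-- Translation moves `x₀` to the origin, and `ψ 0 = 1` removes the points closer than `R`. All four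
interferer processes reduce to this formula. -/
lemma lintegral_radial {k : ℝ → ℝ} (hk : Measurable k) {ψ : ℝ≥0∞ → ℝ≥0∞} (hψ : Measurable ψ)
    (hψ0 : ψ 0 = 1) {a : ℝ → ℝ≥0∞} (ha : Measurable a) (x₀ : Plane) {R : ℝ} (hR : 0 < R) :
    ∫⁻ x, 1 - ψ ({x | R ≤ dist x x₀}.indicator (fun x => a (dist x x₀)) x)
        ∂(volume : Measure Plane).withDensity (fun x => ENNReal.ofReal (k (dist x x₀)))
      = ∫⁻ r in Ioi R, ENNReal.ofReal (k r) * (1 - ψ (a r)) * ENNReal.ofReal (2 * Real.pi * r) := by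
  let f : ℝ → ℝ≥0∞ := (Ici R).indicator fun r => ENNReal.ofReal (k r) * (1 - ψ (a r))
  have hf : Measurable f := Measurable.indicator (by fun_prop) measurableSet_Ici
  have hmd : MeasurableSet {x | R ≤ dist x x₀} := measurableSet_le (by fun_prop) (by fun_prop)
  have hmi : Measurable ({x | R ≤ dist x x₀}.indicator fun x => a (dist x x₀)) :=
    Measurable.indicator (by fun_prop) hmd
  rw [lintegral_withDensity_eq_lintegral_mul _ (by fun_prop) (by fun_prop)]
  have h1 : ∀ x, ((fun x => ENNReal.ofReal (k (dist x x₀))) * fun x =>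
      1 - ψ ({x | R ≤ dist x x₀}.indicator (fun x => a (dist x x₀)) x)) x = f ‖x - x₀‖ := by
    intro x
    rw [← dist_eq_norm]
    by_cases hx : R ≤ dist x x₀
    · simp [f, hx]
    · simp [f, hx, hψ0]
  simp_rw [h1]
  rw [lintegral_sub_right_eq_self (fun x : Plane => f ‖x‖) x₀, lintegral_fun_norm_plane hf]
  have h2 : ∀ r, f r * ENNReal.ofReal (2 * Real.pi * r) = (Ici R).indicator (fun r =>
      ENNReal.ofReal (k r) * (1 - ψ (a r)) * ENNReal.ofReal (2 * Real.pi * r)) r := fun r => by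
    by_cases hr : R ≤ r <;> simp [f, hr]
  simp_rw [h2]
  rw [lintegral_indicator measurableSet_Ici, Measure.restrict_restrict measurableSet_Ici,
    inter_eq_left.2 (Ici_subset_Ioi.2 hR), setLIntegral_congr Ioi_ae_eq_Ici]

end ISAC

namespace ISAC

/-! ### Pairs of shot noises that depend on a common random element -/

section PairShot

variable {α E : Type*}

/-- The sum of two shot noises with weights that depend on a common parameter, as a function of
the parameter, the configurations and the marks. -/
noncomputable def pairShot (g₁ g₂ : α → E → ℝ≥0∞)
    (q : α × ((ℕ∞ × (ℕ → E)) × (ℕ → ℝ≥0∞)) × ((ℕ∞ × (ℕ → E)) × (ℕ → ℝ≥0∞))) : ℝ≥0∞ :=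
  pointSum q.2.1.1 (fun i x => g₁ q.1 x * q.2.1.2 i) +
    pointSum q.2.2.1 (fun i x => g₂ q.1 x * q.2.2.2 i)

variable [MeasurableSpace α] [MeasurableSpace E]

lemma measurable_pairShot {g₁ g₂ : α → E → ℝ≥0∞} (hg₁ : Measurable fun q : α × E => g₁ q.1 q.2)
    (hg₂ : Measurable fun q : α × E => g₂ q.1 q.2) : Measurable (pairShot g₁ g₂) := by
  refine (measurable_pointSum (by fun_prop) fun i => ?_).add
    (measurable_pointSum (by fun_prop) fun i => ?_)
  · exact (hg₁.comp ((measurable_fst.comp measurable_fst).prodMk measurable_snd)).mul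
      (by fun_prop)
  · exact (hg₂.comp ((measurable_fst.comp measurable_fst).prodMk measurable_snd)).mul
      (by fun_prop)

variable {Ω : Type*} [MeasurableSpace Ω] {μ : Measure Ω} {Φ₁ Φ₂ : PointProcess Ω E}
  {Y₁ Y₂ : ℕ → Ω → ℝ≥0∞} {Λ₁ Λ₂ : Measure E} {ψ₁ ψ₂ : ℝ≥0∞ → ℝ≥0∞}

/-- The configurations and marks of two marked point processes. -/
def markedPair (Φ₁ Φ₂ : PointProcess Ω E) (Y₁ Y₂ : ℕ → Ω → ℝ≥0∞) (ω : Ω) :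
    ((ℕ∞ × (ℕ → E)) × (ℕ → ℝ≥0∞)) × ((ℕ∞ × (ℕ → E)) × (ℕ → ℝ≥0∞)) :=
  ((Φ₁.cfg ω, fun i => Y₁ i ω), (Φ₂.cfg ω, fun i => Y₂ i ω))

lemma PointProcess.IsMarkedPoisson.measurable_cfg_marks (h : Φ₁.IsMarkedPoisson Y₁ Λ₁ ψ₁ μ) :
    Measurable fun ω => (Φ₁.cfg ω, fun i => Y₁ i ω) :=
  h.isPoisson.measurable_cfg.prodMk h.measurable_marks

/-- Once the common parameter is frozen, the two noises are independent and their transforms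
multiply. The product stays under the integral over the parameter. -/
lemma lintegral_expNeg_pairShot [IsProbabilityMeasure μ] [SigmaFinite Λ₁] [SigmaFinite Λ₂]
    (h₁ : Φ₁.IsMarkedPoisson Y₁ Λ₁ ψ₁ μ) (h₂ : Φ₂.IsMarkedPoisson Y₂ Λ₂ ψ₂ μ)
    {U : Ω → α} (hU : Measurable U) (hind : IndepFun U (markedPair Φ₁ Φ₂ Y₁ Y₂) μ)
    (hind' : IndepFun (fun ω => (Φ₁.cfg ω, fun i => Y₁ i ω))
      (fun ω => (Φ₂.cfg ω, fun i => Y₂ i ω)) μ)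
    {g₁ g₂ : α → E → ℝ≥0∞} (hg₁ : Measurable fun q : α × E => g₁ q.1 q.2)
    (hg₂ : Measurable fun q : α × E => g₂ q.1 q.2) :
    ∫⁻ ω, expNeg (pairShot g₁ g₂ (U ω, markedPair Φ₁ Φ₂ Y₁ Y₂ ω)) ∂μ
      = ∫⁻ u, expNeg (∫⁻ x, 1 - ψ₁ (g₁ u x) ∂Λ₁) * expNeg (∫⁻ x, 1 - ψ₂ (g₂ u x) ∂Λ₂)
          ∂(μ.map U) := by
  have hV₁ := h₁.measurable_cfg_marks
  have hV₂ := h₂.measurable_cfg_marks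
  have hV : Measurable (markedPair Φ₁ Φ₂ Y₁ Y₂) := hV₁.prodMk hV₂
  rw [lintegral_comp_of_indepFun (F := fun q => expNeg (pairShot g₁ g₂ q)) hU hV hind
    (measurable_expNeg.comp (measurable_pairShot hg₁ hg₂))]
  refine lintegral_congr fun u => ?_
  have hu₁ : Measurable (g₁ u) := hg₁.comp measurable_prodMk_left
  have hu₂ : Measurable (g₂ u) := hg₂.comp measurable_prodMk_left
  have m₁ : Measurable fun v : (ℕ∞ × (ℕ → E)) × (ℕ → ℝ≥0∞) =>
      expNeg (pointSum v.1 fun i x => g₁ u x * v.2 i) :=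
    measurable_expNeg.comp (measurable_pointSum measurable_fst fun i => by fun_prop)
  have m₂ : Measurable fun v : (ℕ∞ × (ℕ → E)) × (ℕ → ℝ≥0∞) =>
      expNeg (pointSum v.1 fun i x => g₂ u x * v.2 i) :=
    measurable_expNeg.comp (measurable_pointSum measurable_fst fun i => by fun_prop)
  have hprod : ∀ ω, expNeg (pairShot g₁ g₂ (u, markedPair Φ₁ Φ₂ Y₁ Y₂ ω))
      = expNeg (pointSum (Φ₁.cfg ω) fun i x => g₁ u x * Y₁ i ω) *
        expNeg (pointSum (Φ₂.cfg ω) fun i x => g₂ u x * Y₂ i ω) := fun ω => expNeg_add _ _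
  rw [lintegral_congr hprod, ← h₁.lintegral_expNeg_shotNoise hu₁,
    ← h₂.lintegral_expNeg_shotNoise hu₂]
  have hi := hind'.comp m₁ m₂
  have e₁ := m₁.comp hV₁
  have e₂ := m₂.comp hV₂
  simp only [Function.comp_def] at hi e₁ e₂
  exact lintegral_mul_eq_lintegral_mul_lintegral_of_indepFun e₁ e₂ hi

end PairShot

/-! ### Radial weights -/

section Radial

variable {α : Type*}

/-- The weight `a u r` of points at distance `r ≥ R u` from `x₀`. -/
noncomputable def radialWeight (x₀ : Plane) (R : α → ℝ) (a : α → ℝ → ℝ≥0∞) (u : α) (x : Plane) :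
    ℝ≥0∞ :=
  {x | R u ≤ dist x x₀}.indicator (fun x => a u (dist x x₀)) x

lemma measurable_radialWeight [MeasurableSpace α] (x₀ : Plane) {R : α → ℝ} (hR : Measurable R)
    {a : α → ℝ → ℝ≥0∞} (ha : Measurable fun q : α × ℝ => a q.1 q.2) :
    Measurable fun q : α × Plane => radialWeight x₀ R a q.1 q.2 := by
  simp only [radialWeight]
  exact Measurable.ite (p := fun q : α × Plane => R q.1 ≤ dist q.2 x₀)
    (measurableSet_le (by fun_prop) (by fun_prop))
    (ha.comp (measurable_fst.prodMk (by fun_prop))) measurable_const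

end Radial

/-! ### Laws with a density -/

/-- `H` may be arbitrary because the density is finite, so measurability of inner integrals never
has to be checked. -/
lemma lintegral_lawOfPDF {f h : ℝ → ℝ} {s : Set ℝ} (hs : MeasurableSet s) (hh : Measurable h)
    (hf : f = s.indicator h) (H : ℝ → ℝ≥0∞) :
    ∫⁻ x, H x ∂(lawOfPDF f) = ∫⁻ x in s, ENNReal.ofReal (h x) * H x := by
  have hfm : Measurable f := hf ▸ hh.indicator hs
  rw [lawOfPDF, lintegral_withDensity_eq_lintegral_mul_non_measurable _ hfm.ennreal_ofReal
    (by simp), ← lintegral_indicator hs]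
  refine lintegral_congr fun x => ?_
  by_cases hx : x ∈ s <;> simp [hf, hx]

lemma ae_mem_lawOfPDF {f h : ℝ → ℝ} {s : Set ℝ} (hs : MeasurableSet s) (hh : Measurable h)
    (hf : f = s.indicator h) : ∀ᵐ x ∂(lawOfPDF f), x ∈ s := by
  have hfm : Measurable f := hf ▸ hh.indicator hs
  rw [lawOfPDF, ae_withDensity_iff hfm.ennreal_ofReal]
  refine ae_of_all _ fun x hx => ?_
  by_contra hxs
  exact hx (by simp [hf, hxs])

end ISAC

namespace ISAC

/-! ### Marked Poisson processes of the model -/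

namespace Sources

variable {Ω : Type*} (S : Sources Ω)

/-- The σ-algebra generated by the primitive random elements with labels in `T`. -/
abbrev gen (T : Set Label) : MeasurableSpace Ω := ⨆ ℓ ∈ T, S.sigma ℓ

/-- The marks of the points of each process. -/
noncomputable def clutterMark (i : ℕ) (ω : Ω) : ℝ≥0∞ := ENNReal.ofReal (S.clutterRCS i ω)

noncomputable def losMark (i : ℕ) (ω : Ω) : ℝ≥0∞ := ENNReal.ofReal (S.hL i ω)

noncomputable def nlosMark (i : ℕ) (ω : Ω) : ℝ≥0∞ := ENNReal.ofReal (S.hN i ω)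

noncomputable def ic1Mark (n : ℕ) (ω : Ω) : ℝ≥0∞ := ENNReal.ofReal (S.ic1RCS n ω)

noncomputable def ic2ClutterMark (n i : ℕ) (ω : Ω) : ℝ≥0∞ := ENNReal.ofReal (S.ic2RCS n i ω)

/-- The total RCS of the scatterers met by the `n`-th inter-clutter interferer. -/
noncomputable def ic2Mark (A : Set Plane) (n : ℕ) (ω : Ω) : ℝ≥0∞ :=
  pointSum ((S.ic2Clutter n).cfg ω) fun i x => A.indicator 1 x * S.ic2ClutterMark n i ω

variable {S}

lemma measurable_gen {α : Type*} [MeasurableSpace α] {f : Ω → α} {ℓ : Label} {T : Set Label}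
    (hℓ : ℓ ∈ T) (h : Measurable[S.sigma ℓ] f) : Measurable[S.gen T] f :=
  h.mono (le_biSup S.sigma hℓ) le_rfl

section Gen

variable {T : Set Label}

lemma measurable_gen_cfg {Φ : PointProcess Ω Plane} {ℓ : Label} (hℓ : ℓ ∈ T)
    (h : S.sigma ℓ = Φ.sigma) : Measurable[S.gen T] Φ.cfg :=
  measurable_gen hℓ (h ▸ comap_measurable _)

lemma measurable_gen_mark {X : Ω → ℝ} {ℓ : Label} (hℓ : ℓ ∈ T)
    (h : S.sigma ℓ = MeasurableSpace.comap X inferInstance) :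
    Measurable[S.gen T] fun ω => ENNReal.ofReal (X ω) :=
  ENNReal.measurable_ofReal.comp (measurable_gen hℓ (h ▸ comap_measurable _))

lemma measurable_gen_marked {Φ : PointProcess Ω Plane} {Y : ℕ → Ω → ℝ≥0∞}
    (hΦ : Measurable[S.gen T] Φ.cfg) (hY : ∀ i, Measurable[S.gen T] (Y i)) :
    Measurable[S.gen T] fun ω => (Φ.cfg ω, fun i => Y i ω) :=
  hΦ.prodMk (@measurable_pi_lambda _ _ _ (S.gen T) _ _ hY)

lemma measurable_gen_ic2Mark {A : Set Plane} (hA : MeasurableSet A) {n : ℕ}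
    (h : Label.ic2Clutter n ∈ T) (h' : ∀ i, Label.ic2RCS n i ∈ T) :
    Measurable[S.gen T] (S.ic2Mark A n) := by
  have hm : Measurable fun v : (ℕ∞ × (ℕ → Plane)) × (ℕ → ℝ≥0∞) =>
      pointSum v.1 fun i x => A.indicator 1 x * v.2 i :=
    measurable_pointSum measurable_fst fun i =>
      ((measurable_one.indicator hA).comp measurable_snd).mul (by fun_prop)
  exact hm.comp (measurable_gen_marked (measurable_gen_cfg h rfl) fun i =>
    measurable_gen_mark (h' i) rfl)

end Gen

namespace IsModel

variable [MeasurableSpace Ω] {p : Params} {xt : Plane} {R₁ : ℝ} {μ : Measure Ω}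

lemma sigma_le (hS : S.IsModel p xt R₁ μ) (ℓ : Label) : S.sigma ℓ ≤ ‹MeasurableSpace Ω› := by
  cases ℓ with
  | targetRCS => exact hS.targetRCS.1.comap_le
  | clutter => exact hS.clutter.measurable_cfg.comap_le
  | clutterRCS i => exact (hS.clutterRCS i).1.comap_le
  | Rd => exact hS.Rd.1.comap_le
  | los => exact hS.los.measurable_cfg.comap_le
  | hL i => exact (hS.hL i).1.comap_le
  | nlos => exact hS.nlos.measurable_cfg.comap_le
  | hN i => exact (hS.hN i).1.comap_le
  | Ric => exact hS.Ric.1.comap_le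
  | β => exact hS.β.1.comap_le
  | ic1 => exact hS.ic1.measurable_cfg.comap_le
  | ic1RCS n => exact (hS.ic1RCS n).1.comap_le
  | ic2 => exact hS.ic2.measurable_cfg.comap_le
  | ic2Clutter n => exact (hS.ic2Clutter n).measurable_cfg.comap_le
  | ic2RCS n i => exact (hS.ic2RCS n i).1.comap_le

lemma gen_le (hS : S.IsModel p xt R₁ μ) (T : Set Label) : S.gen T ≤ ‹MeasurableSpace Ω› :=
  iSup₂_le fun ℓ _ => hS.sigma_le ℓ

lemma indepFun {α β : Type*} [MeasurableSpace α] [MeasurableSpace β] (hS : S.IsModel p xt R₁ μ)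
    {T T' : Set Label} (hT : Disjoint T T') {f : Ω → α} {g : Ω → β}
    (hf : Measurable[S.gen T] f) (hg : Measurable[S.gen T'] g) : IndepFun f g μ :=
  indepFun_of_measurable_iSup hS.sigma_le hS.indep hT hf hg

/-- Each mark may depend on a whole block `T' i` of sources, since an inter-clutter mark uses a
clutter process and all its RCSs. -/
lemma isMarkedPoisson [IsProbabilityMeasure μ] (hS : S.IsModel p xt R₁ μ)
    {Φ : PointProcess Ω Plane} {Λ : Measure Plane} (hΦ : Φ.IsPoisson Λ μ) {Y : ℕ → Ω → ℝ≥0∞}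
    {ψ : ℝ≥0∞ → ℝ≥0∞} (hψ : Measurable ψ) (hY : ∀ i s, ∫⁻ ω, expNeg (s * Y i ω) ∂μ = ψ s)
    {T : Set Label} {T' : ℕ → Set Label} (hT : ∀ i, Disjoint T (T' i))
    (hT' : Pairwise fun i j => Disjoint (T' i) (T' j)) (hm : Measurable[S.gen T] Φ.cfg)
    (hm' : ∀ i, Measurable[S.gen (T' i)] (Y i)) : Φ.IsMarkedPoisson Y Λ ψ μ where
  isPoisson := hΦ
  measurable_mark i := (hm' i).mono (hS.gen_le _) le_rfl
  iIndepFun_mark := iIndepFun_of_measurable_iSup hS.sigma_le hS.indep hT' hm'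
  indepFun := by
    have hle : ∀ i, S.gen (T' i) ≤ S.gen (⋃ i, T' i) := fun i =>
      biSup_mono fun ℓ hℓ => Set.mem_iUnion_of_mem i hℓ
    exact hS.indepFun (Set.disjoint_iUnion_right.2 hT) hm
      (@measurable_pi_lambda _ _ _ (S.gen (⋃ i, T' i)) _ _
        fun i => (hm' i).mono (hle i) le_rfl)
  measurable_laplace := hψ
  laplace_mark := hY

lemma isMarkedPoisson_of_isRV [IsProbabilityMeasure μ] (hS : S.IsModel p xt R₁ μ)
    {Φ : PointProcess Ω Plane} {Λ : Measure Plane} (hΦ : Φ.IsPoisson Λ μ) {X : ℕ → Ω → ℝ}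
    {ν : Measure ℝ} [SFinite ν] (hX : ∀ i, IsRV (X i) ν μ) {ℓ : Label} {ℓ' : ℕ → Label}
    (hℓ : ∀ i, ℓ ≠ ℓ' i) (hℓ' : Function.Injective ℓ') (h : S.sigma ℓ = Φ.sigma)
    (h' : ∀ i, S.sigma (ℓ' i) = MeasurableSpace.comap (X i) inferInstance) :
    Φ.IsMarkedPoisson (fun i ω => ENNReal.ofReal (X i ω)) Λ (laplace ν) μ := by
  refine hS.isMarkedPoisson hΦ (measurable_laplace ν) (fun i s => ?_) (T := {ℓ})
    (T' := fun i => {ℓ' i}) (fun i => by simpa using hℓ i)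
    (fun i j hij => by simpa using hℓ'.ne hij) (measurable_gen_cfg rfl h)
    fun i => measurable_gen_mark rfl (h' i)
  rw [laplace, ← (hX i).2.map_eq, lintegral_map (by fun_prop) (hX i).1]

lemma isMarkedPoisson_clutter [IsProbabilityMeasure μ] (hS : S.IsModel p xt R₁ μ) :
    S.clutter.IsMarkedPoisson S.clutterMark p.clutterIntensity (laplace (expMeasure (1 / p.σcl)))
      μ := by
  have := isProbabilityMeasure_expMeasure (one_div_pos.2 p.σcl_pos)
  exact hS.isMarkedPoisson_of_isRV hS.clutter hS.clutterRCS (ℓ := .clutter) (ℓ' := .clutterRCS)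
    (fun _ => by simp) (fun _ _ => by simp) rfl fun _ => rfl

lemma isMarkedPoisson_los [IsProbabilityMeasure μ] (hS : S.IsModel p xt R₁ μ) :
    S.los.IsMarkedPoisson S.losMark p.losIntensity (laplace (gammaMeasure p.mL p.mL)) μ := by
  have := isProbabilityMeasure_gammaMeasure p.mL_pos p.mL_pos
  exact hS.isMarkedPoisson_of_isRV hS.los hS.hL (ℓ := .los) (ℓ' := .hL)
    (fun _ => by simp) (fun _ _ => by simp) rfl fun _ => rfl

lemma isMarkedPoisson_nlos [IsProbabilityMeasure μ] (hS : S.IsModel p xt R₁ μ) :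
    S.nlos.IsMarkedPoisson S.nlosMark p.nlosIntensity (laplace (gammaMeasure p.mN p.mN)) μ := by
  have := isProbabilityMeasure_gammaMeasure p.mN_pos p.mN_pos
  exact hS.isMarkedPoisson_of_isRV hS.nlos hS.hN (ℓ := .nlos) (ℓ' := .hN)
    (fun _ => by simp) (fun _ _ => by simp) rfl fun _ => rfl

lemma isMarkedPoisson_ic1 [IsProbabilityMeasure μ] (hS : S.IsModel p xt R₁ μ) :
    S.ic1.IsMarkedPoisson S.ic1Mark (p.icIntensity xt) (laplace (expMeasure (1 / p.σt))) μ := by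
  have := isProbabilityMeasure_expMeasure (one_div_pos.2 p.σt_pos)
  exact hS.isMarkedPoisson_of_isRV hS.ic1 hS.ic1RCS (ℓ := .ic1) (ℓ' := .ic1RCS)
    (fun _ => by simp) (fun _ _ => by simp) rfl fun _ => rfl

lemma isMarkedPoisson_ic2Clutter [IsProbabilityMeasure μ] (hS : S.IsModel p xt R₁ μ) (n : ℕ) :
    (S.ic2Clutter n).IsMarkedPoisson (S.ic2ClutterMark n) p.clutterIntensity
      (laplace (expMeasure (1 / p.σcl))) μ := by
  have := isProbabilityMeasure_expMeasure (one_div_pos.2 p.σcl_pos)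
  exact hS.isMarkedPoisson_of_isRV (hS.ic2Clutter n) (hS.ic2RCS n) (ℓ := .ic2Clutter n)
    (ℓ' := .ic2RCS n) (fun _ => by simp) (fun _ _ => by simp) rfl fun _ => rfl

end IsModel

end Sources

instance (p : Params) : SigmaFinite p.clutterIntensity := by
  exact inferInstanceAs (SigmaFinite (p.lamCl.toNNReal • (volume : Measure Plane)))

instance (p : Params) : SigmaFinite p.losIntensity := by
  unfold Params.losIntensity
  infer_instance

instance (p : Params) : SigmaFinite p.nlosIntensity := by
  unfold Params.nlosIntensity
  infer_instance

instance (p : Params) (xt : Plane) : SigmaFinite (p.icIntensity xt) := by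
  unfold Params.icIntensity
  infer_instance

/-- The Laplace transform of the total RCS of the scatterers in a set. -/
lemma lintegral_expNeg_clutter {Ω : Type*} [MeasurableSpace Ω] {μ : Measure Ω}
    [IsProbabilityMeasure μ] {Φ : PointProcess Ω Plane} {Y : ℕ → Ω → ℝ≥0∞} {Λ : Measure Plane}
    [SigmaFinite Λ] {ψ : ℝ≥0∞ → ℝ≥0∞} (h : Φ.IsMarkedPoisson Y Λ ψ μ) {A : Set Plane}
    (hA : MeasurableSet A) (s : ℝ≥0∞) :
    ∫⁻ ω, expNeg (s * pointSum (Φ.cfg ω) fun i x => A.indicator 1 x * Y i ω) ∂μ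
      = expNeg (Λ A * (1 - ψ s)) := by
  simp_rw [pointSum_const_mul, ← mul_assoc]
  rw [h.lintegral_expNeg_shotNoise ((measurable_one.indicator hA).const_mul s)]
  have : ∀ x, 1 - ψ (s * A.indicator 1 x) = A.indicator (fun _ => 1 - ψ s) x := fun x => by
    by_cases hx : x ∈ A <;> simp [hx, h.laplace_zero]
  simp_rw [this]
  rw [lintegral_indicator hA, setLIntegral_const, mul_comm]

namespace Sources.IsModel

variable {Ω : Type*} {S : Sources Ω} [MeasurableSpace Ω] {p : Params} {xt : Plane} {R₁ : ℝ}
  {μ : Measure Ω} [IsProbabilityMeasure μ]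

/-- The total RCS met by an interferer is a compound Poisson variable with an explicit transform;
different interferers use disjoint blocks of sources, which makes these marks independent. -/
lemma isMarkedPoisson_ic2 (hS : S.IsModel p xt R₁ μ) {A : Set Plane} (hA : MeasurableSet A) :
    S.ic2.IsMarkedPoisson (S.ic2Mark A) (p.icIntensity xt)
      (fun s => expNeg (p.clutterIntensity A * (1 - laplace (expMeasure (1 / p.σcl)) s))) μ := by
  have := isProbabilityMeasure_expMeasure (one_div_pos.2 p.σcl_pos)
  refine hS.isMarkedPoisson hS.ic2 (by fun_prop)
    (fun n s => lintegral_expNeg_clutter (hS.isMarkedPoisson_ic2Clutter n) hA s)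
    (T := {.ic2}) (T' := fun n => insert (.ic2Clutter n) (Set.range (.ic2RCS n)))
    (fun n => by simp) (fun m n hmn => ?_) (measurable_gen_cfg rfl rfl)
    fun n => measurable_gen_ic2Mark hA (by simp) (by simp)
  refine Set.disjoint_left.2 ?_
  rintro ℓ (rfl | ⟨i, rfl⟩) <;> simp [hmn, Ne.symm hmn]

end Sources.IsModel

/-- The groups of labels on which the components of the SINR depend. -/
def Label.group : Label → ℕ
  | .targetRCS => 0
  | .clutter => 1
  | .clutterRCS _ => 1
  | .Rd => 2
  | .los => 3
  | .hL _ => 3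
  | .nlos => 4
  | .hN _ => 4
  | .Ric => 5
  | .β => 6
  | .ic1 => 7
  | .ic1RCS _ => 7
  | .ic2 => 8
  | .ic2Clutter _ => 8
  | .ic2RCS _ _ => 8

/-! ### Independent groups of sources behind the SINR terms -/

namespace Sources

variable {Ω : Type*} (S : Sources Ω)

/-- The random elements on which the inter-clutter interference depends. -/
noncomputable def icData (A : Set Plane) (ω : Ω) :=
  ((S.Ric ω, S.β ω), markedPair S.ic1 S.ic2 S.ic1Mark (S.ic2Mark A) ω)

/-- The random elements on which the direct interference depends. -/
noncomputable def directData (ω : Ω) :=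
  (S.Rd ω, markedPair S.los S.nlos S.losMark S.nlosMark ω)

/-- The random elements on which the intra-clutter interference depends. -/
noncomputable def clutterData (ω : Ω) := (S.clutter.cfg ω, fun i => S.clutterMark i ω)

variable {S} {s : Set ℕ}

lemma measurable_gen_clutterData (h : 1 ∈ s) :
    Measurable[S.gen (Label.group ⁻¹' s)] S.clutterData :=
  measurable_gen_marked (measurable_gen_cfg (ℓ := .clutter) h rfl) fun i =>
    measurable_gen_mark (ℓ := .clutterRCS i) h rfl

lemma measurable_gen_losData (h : 3 ∈ s) :
    Measurable[S.gen (Label.group ⁻¹' s)] fun ω => (S.los.cfg ω, fun i => S.losMark i ω) :=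
  measurable_gen_marked (measurable_gen_cfg (ℓ := .los) h rfl) fun i =>
    measurable_gen_mark (ℓ := .hL i) h rfl

lemma measurable_gen_nlosData (h : 4 ∈ s) :
    Measurable[S.gen (Label.group ⁻¹' s)] fun ω => (S.nlos.cfg ω, fun i => S.nlosMark i ω) :=
  measurable_gen_marked (measurable_gen_cfg (ℓ := .nlos) h rfl) fun i =>
    measurable_gen_mark (ℓ := .hN i) h rfl

lemma measurable_gen_ic1Data (h : 7 ∈ s) :
    Measurable[S.gen (Label.group ⁻¹' s)] fun ω => (S.ic1.cfg ω, fun i => S.ic1Mark i ω) :=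
  measurable_gen_marked (measurable_gen_cfg (ℓ := .ic1) h rfl) fun i =>
    measurable_gen_mark (ℓ := .ic1RCS i) h rfl

lemma measurable_gen_ic2Data {A : Set Plane} (hA : MeasurableSet A) (h : 8 ∈ s) :
    Measurable[S.gen (Label.group ⁻¹' s)] fun ω => (S.ic2.cfg ω, fun i => S.ic2Mark A i ω) :=
  measurable_gen_marked (measurable_gen_cfg (ℓ := .ic2) h rfl) fun _ =>
    measurable_gen_ic2Mark hA h fun _ => h

lemma measurable_gen_real {X : Ω → ℝ} {ℓ : Label} (hℓ : ℓ.group ∈ s)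
    (h : S.sigma ℓ = MeasurableSpace.comap X inferInstance) :
    Measurable[S.gen (Label.group ⁻¹' s)] X :=
  measurable_gen (ℓ := ℓ) hℓ (h ▸ comap_measurable _)

lemma measurable_gen_icData {A : Set Plane} (hA : MeasurableSet A) (h : {5, 6, 7, 8} ⊆ s) :
    Measurable[S.gen (Label.group ⁻¹' s)] (S.icData A) := by
  have h5 : Measurable[S.gen (Label.group ⁻¹' s)] S.Ric :=
    measurable_gen_real (ℓ := .Ric) (h (by simp [Label.group])) rfl
  have h6 : Measurable[S.gen (Label.group ⁻¹' s)] S.β :=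
    measurable_gen_real (ℓ := .β) (h (by simp [Label.group])) rfl
  exact (h5.prodMk h6).prodMk ((measurable_gen_ic1Data (h (by simp))).prodMk
    (measurable_gen_ic2Data hA (h (by simp))))

lemma measurable_gen_directData (h : {2, 3, 4} ⊆ s) :
    Measurable[S.gen (Label.group ⁻¹' s)] S.directData := by
  have h2 : Measurable[S.gen (Label.group ⁻¹' s)] S.Rd :=
    measurable_gen_real (ℓ := .Rd) (h (by simp [Label.group])) rfl
  exact h2.prodMk ((measurable_gen_losData (h (by simp))).prodMk
    (measurable_gen_nlosData (h (by simp))))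

namespace IsModel

variable [MeasurableSpace Ω] {p : Params} {xt : Plane} {R₁ : ℝ} {μ : Measure Ω}

lemma indepFun_group {α β : Type*} [MeasurableSpace α] [MeasurableSpace β]
    (hS : S.IsModel p xt R₁ μ) (s t : Set ℕ) (hst : Disjoint s t) {f : Ω → α} {g : Ω → β}
    (hf : Measurable[S.gen (Label.group ⁻¹' s)] f)
    (hg : Measurable[S.gen (Label.group ⁻¹' t)] g) : IndepFun f g μ :=
  hS.indepFun (hst.preimage _) hf hg

lemma indepFun_Ric_β (hS : S.IsModel p xt R₁ μ) : IndepFun S.Ric S.β μ :=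
  hS.indepFun_group {5} {6} (by simp) (measurable_gen_real (ℓ := .Ric) rfl rfl)
    (measurable_gen_real (ℓ := .β) rfl rfl)

variable [IsProbabilityMeasure μ]

lemma lintegral_expNeg_ic (hS : S.IsModel p xt R₁ μ) {A : Set Plane} (hA : MeasurableSet A)
    {g : ℝ × ℝ → Plane → ℝ≥0∞} (hg : Measurable fun q : (ℝ × ℝ) × Plane => g q.1 q.2) :
    ∫⁻ ω, expNeg (pairShot g g (S.icData A ω)) ∂μ
      = ∫⁻ u, expNeg (∫⁻ x, 1 - laplace (expMeasure (1 / p.σt)) (g u x) ∂(p.icIntensity xt)) *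
          expNeg (∫⁻ x, 1 - expNeg (p.clutterIntensity A *
            (1 - laplace (expMeasure (1 / p.σcl)) (g u x))) ∂(p.icIntensity xt))
          ∂(μ.map fun ω => (S.Ric ω, S.β ω)) := by
  have h1 : Measurable[S.gen (Label.group ⁻¹' {5, 6})] fun ω => (S.Ric ω, S.β ω) :=
    (measurable_gen_real (ℓ := .Ric) (by simp [Label.group]) rfl).prodMk
      (measurable_gen_real (ℓ := .β) (by simp [Label.group]) rfl)
  have h2 : Measurable[S.gen (Label.group ⁻¹' {7, 8})]
      (markedPair S.ic1 S.ic2 S.ic1Mark (S.ic2Mark A)) :=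
    (measurable_gen_ic1Data (by simp)).prodMk (measurable_gen_ic2Data hA (by simp))
  exact lintegral_expNeg_pairShot hS.isMarkedPoisson_ic1 (hS.isMarkedPoisson_ic2 hA)
    (hS.Ric.1.prodMk hS.β.1) (hS.indepFun_group {5, 6} {7, 8} (by simp) h1 h2)
    (hS.indepFun_group {7} {8} (by simp) (measurable_gen_ic1Data rfl)
      (measurable_gen_ic2Data hA rfl)) hg hg

lemma lintegral_expNeg_direct (hS : S.IsModel p xt R₁ μ) {g₁ g₂ : ℝ → Plane → ℝ≥0∞}
    (hg₁ : Measurable fun q : ℝ × Plane => g₁ q.1 q.2)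
    (hg₂ : Measurable fun q : ℝ × Plane => g₂ q.1 q.2) :
    ∫⁻ ω, expNeg (pairShot g₁ g₂ (S.directData ω)) ∂μ
      = ∫⁻ u, expNeg (∫⁻ x, 1 - laplace (gammaMeasure p.mL p.mL) (g₁ u x) ∂p.losIntensity) *
          expNeg (∫⁻ x, 1 - laplace (gammaMeasure p.mN p.mN) (g₂ u x) ∂p.nlosIntensity)
          ∂(μ.map S.Rd) := by
  have h2 : Measurable[S.gen (Label.group ⁻¹' {3, 4})]
      (markedPair S.los S.nlos S.losMark S.nlosMark) :=
    (measurable_gen_losData (by simp)).prodMk (measurable_gen_nlosData (by simp))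
  exact lintegral_expNeg_pairShot hS.isMarkedPoisson_los hS.isMarkedPoisson_nlos
    hS.Rd.1 (hS.indepFun_group {2} {3, 4} (by simp) (measurable_gen_real (ℓ := .Rd) rfl rfl) h2)
    (hS.indepFun_group {3} {4} (by simp) (measurable_gen_losData rfl)
      (measurable_gen_nlosData rfl)) hg₁ hg₂

end IsModel

end Sources

end ISAC

namespace ISAC

open Set

/-! ### Closed forms -/

lemma one_sub_ofReal {y : ℝ} (hy : 0 ≤ y) : 1 - ENNReal.ofReal y = ENNReal.ofReal (1 - y) := by
  rw [ENNReal.ofReal_sub _ hy, ENNReal.ofReal_one]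

namespace Params

variable (p : Params)

/-- The weights of the inter-clutter interferers, depending on the protection radius and the
bistatic angle. -/
noncomputable def icWeight (xt : Plane) (s : ℝ) : ℝ × ℝ → Plane → ℝ≥0∞ :=
  radialWeight xt Prod.fst fun u r => ENNReal.ofReal (s * Real.cos (u.2 / 2) * r ^ (-p.ηL))

/-- The weights of direct interferers with path-loss intercept `C` and exponent `η`, depending on
the protection radius. -/
noncomputable def directWeight (C η s : ℝ) : ℝ → Plane → ℝ≥0∞ :=
  radialWeight 0 id fun _ r => ENNReal.ofReal (s * p.Pc * p.Gm ^ 2 * C * r ^ (-η))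

lemma measurable_icWeight (xt : Plane) (s : ℝ) :
    Measurable fun q : (ℝ × ℝ) × Plane => p.icWeight xt s q.1 q.2 :=
  measurable_radialWeight xt measurable_fst (by fun_prop)

lemma measurable_directWeight (C η s : ℝ) :
    Measurable fun q : ℝ × Plane => p.directWeight C η s q.1 q.2 :=
  measurable_radialWeight 0 measurable_id (by fun_prop)

@[fun_prop]
lemma measurable_pLOS : Measurable p.pLOS := by
  unfold pLOS
  fun_prop

lemma pLOS_nonneg (r : ℝ) : 0 ≤ p.pLOS r := (Real.exp_pos _).le

lemma pLOS_le_one {r : ℝ} (hr : 0 ≤ r) : p.pLOS r ≤ 1 := by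
  rw [pLOS, Real.exp_le_one_iff]
  have := mul_nonneg p.γ_nonneg hr
  linarith

lemma cellArea_nonneg {R₁ : ℝ} (hR₁ : 0 < R₁) : 0 ≤ p.cellArea R₁ := by
  have := p.c_pos; have := p.Wb_pos; have := Real.pi_pos
  unfold cellArea θB
  positivity

lemma expNeg_lintegral_ic1 (xt : Plane) {s R β : ℝ} (hs : 0 ≤ s) (hR : 0 < R)
    (hβ : 0 ≤ Real.cos (β / 2)) :
    expNeg (∫⁻ x, 1 - laplace (expMeasure (1 / p.σt)) (p.icWeight xt s (R, β) x)
      ∂(p.icIntensity xt)) = p.ltIC1 s R β := by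
  have := isProbabilityMeasure_expMeasure (one_div_pos.2 p.σt_pos)
  have hσ := p.σt_pos
  have hl := p.lamBS_pos
  rw [ltIC1, icIntensity]
  congr 1
  refine (lintegral_radial (k := fun r => p.pLOS r * (p.lamBS / p.M)) (by fun_prop)
    (measurable_laplace (expMeasure (1 / p.σt))) (laplace_zero _)
    (a := fun r => ENNReal.ofReal (s * Real.cos (β / 2) * r ^ (-p.ηL))) (by fun_prop) xt hR).trans ?_
  refine setLIntegral_congr_fun measurableSet_Ioi fun r (hr : R < r) => ?_
  have hr0 : 0 < r := hR.trans hr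
  have hw : 0 ≤ s * Real.cos (β / 2) * r ^ (-p.ηL) := by positivity
  have hpl := p.pLOS_nonneg r
  have hq : 1 / (1 + s * Real.cos (β / 2) * r ^ (-p.ηL) * p.σt) ≤ 1 := by
    rw [div_le_one (by positivity)]
    have := mul_nonneg hw hσ.le
    linarith
  rw [laplace_expMeasure hσ hw, one_sub_ofReal (by positivity),
    ← ENNReal.ofReal_mul (by positivity),
    ← ENNReal.ofReal_mul (mul_nonneg (by positivity) (by linarith))]
  congr 1
  ring

lemma one_sub_laplace_clutter {z : ℝ} (hz : 0 ≤ z) :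
    1 - laplace (expMeasure (1 / p.σcl)) (ENNReal.ofReal z)
      = ENNReal.ofReal (z * p.σcl / (1 + z * p.σcl)) := by
  have hσ := p.σcl_pos
  rw [laplace_expMeasure hσ hz, one_sub_ofReal (by positivity)]
  congr 1
  field_simp
  ring

lemma expNeg_clutter {R₁ z : ℝ} (hR₁ : 0 < R₁) {A : Set Plane}
    (hvol : volume A = ENNReal.ofReal (p.cellArea R₁)) (hz : 0 ≤ z) :
    expNeg (p.clutterIntensity A * (1 - laplace (expMeasure (1 / p.σcl)) (ENNReal.ofReal z)))
      = ENNReal.ofReal (Real.exp (-(p.lamCl * p.cellArea R₁ * (z * p.σcl / (1 + z * p.σcl))))) := by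
  have hσ := p.σcl_pos
  have hl := p.lamCl_nonneg
  have ha := p.cellArea_nonneg hR₁
  rw [p.one_sub_laplace_clutter hz, clutterIntensity, Measure.smul_apply, hvol, smul_eq_mul,
    ← ENNReal.ofReal_mul hl, ← ENNReal.ofReal_mul (by positivity), expNeg_ofReal (by positivity)]

lemma expNeg_lintegral_ic2 (xt : Plane) {R₁ s R β : ℝ} (hR₁ : 0 < R₁) {A : Set Plane}
    (hvol : volume A = ENNReal.ofReal (p.cellArea R₁)) (hs : 0 ≤ s) (hR : 0 < R)
    (hβ : 0 ≤ Real.cos (β / 2)) :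
    expNeg (∫⁻ x, 1 - expNeg (p.clutterIntensity A *
      (1 - laplace (expMeasure (1 / p.σcl)) (p.icWeight xt s (R, β) x))) ∂(p.icIntensity xt))
      = p.ltIC2 R₁ s R β := by
  have := isProbabilityMeasure_expMeasure (one_div_pos.2 p.σcl_pos)
  have hσ := p.σcl_pos
  have hl := p.lamBS_pos
  rw [ltIC2, icIntensity]
  congr 1
  refine (lintegral_radial (k := fun r => p.pLOS r * (p.lamBS / p.M)) (by fun_prop)
    (ψ := fun z => expNeg (p.clutterIntensity A * (1 - laplace (expMeasure (1 / p.σcl)) z)))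
    (by fun_prop) (by simp [-one_div, laplace_zero])
    (a := fun r => ENNReal.ofReal (s * Real.cos (β / 2) * r ^ (-p.ηL))) (by fun_prop) xt hR).trans ?_
  refine setLIntegral_congr_fun measurableSet_Ioi fun r (hr : R < r) => ?_
  have hr0 : 0 < r := hR.trans hr
  have hw : 0 ≤ s * Real.cos (β / 2) * r ^ (-p.ηL) := by positivity
  have hpl := p.pLOS_nonneg r
  have hq : Real.exp (-(p.lamCl * p.cellArea R₁ * (s * Real.cos (β / 2) * r ^ (-p.ηL) * p.σcl /
      (1 + s * Real.cos (β / 2) * r ^ (-p.ηL) * p.σcl)))) ≤ 1 := by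
    rw [Real.exp_le_one_iff, neg_nonpos]
    have := p.cellArea_nonneg hR₁
    have := p.lamCl_nonneg
    positivity
  rw [p.expNeg_clutter hR₁ hvol hw, one_sub_ofReal (Real.exp_pos _).le,
    ← ENNReal.ofReal_mul (by positivity),
    ← ENNReal.ofReal_mul (mul_nonneg (by positivity) (by linarith))]
  simp only [cellArea]
  congr 1
  ring

/-- Serves LoS and NLoS alike. Nonnegativity of `k` is asked only for `r ≥ 0`, because `1 - p.pLOS
r` can be negative for `r < 0`. -/
lemma expNeg_lintegral_direct {k : ℝ → ℝ} (hk : Measurable k) (hk0 : ∀ r, 0 ≤ r → 0 ≤ k r)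
    {C η m s R : ℝ} (hC : 0 < C) (hm : 0 < m) (hs : 0 ≤ s) (hR : 0 < R) :
    expNeg (∫⁻ x, 1 - laplace (gammaMeasure m m) (p.directWeight C η s R x)
      ∂(volume.withDensity fun x => ENNReal.ofReal (k ‖x‖ * (p.lamBS / (p.M : ℝ) ^ 2))))
      = expNeg (∫⁻ r in Set.Ioi R, ENNReal.ofReal
          (2 * Real.pi * p.lamBS * (1 / (p.M : ℝ) ^ 2) * k r *
            (1 - (1 + s * p.Pc * p.Gm ^ 2 * C * r ^ (-η) / m) ^ (-m)) * r)) := by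
  have := isProbabilityMeasure_gammaMeasure hm hm
  have hl := p.lamBS_pos
  have hPc := p.Pc_nonneg
  simp_rw [← fun x : Plane => dist_zero_right x]
  congr 1
  refine (lintegral_radial (k := fun r => k r * (p.lamBS / (p.M : ℝ) ^ 2)) (by fun_prop)
    (measurable_laplace (gammaMeasure m m)) (laplace_zero _)
    (a := fun r => ENNReal.ofReal (s * p.Pc * p.Gm ^ 2 * C * r ^ (-η))) (by fun_prop) 0 hR).trans ?_
  refine setLIntegral_congr_fun measurableSet_Ioi fun r (hr : R < r) => ?_
  have hr0 : 0 < r := hR.trans hr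
  have hw : 0 ≤ s * p.Pc * p.Gm ^ 2 * C * r ^ (-η) := by positivity
  have hkr := hk0 r hr0.le
  have hq : (1 + s * p.Pc * p.Gm ^ 2 * C * r ^ (-η) / m) ^ (-m) ≤ 1 := by
    refine Real.rpow_le_one_of_one_le_of_nonpos ?_ (by linarith)
    have := div_nonneg hw hm.le
    linarith
  rw [laplace_gammaMeasure hm hm hw, one_sub_ofReal (by positivity),
    ← ENNReal.ofReal_mul (by positivity),
    ← ENNReal.ofReal_mul (mul_nonneg (by positivity) (by linarith))]
  congr 1
  ring

lemma expNeg_lintegral_los {s R : ℝ} (hs : 0 ≤ s) (hR : 0 < R) :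
    expNeg (∫⁻ x, 1 - laplace (gammaMeasure p.mL p.mL) (p.directWeight p.CL p.ηL s R x)
      ∂p.losIntensity) = p.ltLoS s R :=
  p.expNeg_lintegral_direct p.measurable_pLOS (fun r _ => p.pLOS_nonneg r) p.CL_pos p.mL_pos hs hR

lemma expNeg_lintegral_nlos {s R : ℝ} (hs : 0 ≤ s) (hR : 0 < R) :
    expNeg (∫⁻ x, 1 - laplace (gammaMeasure p.mN p.mN) (p.directWeight p.CN p.ηN s R x)
      ∂p.nlosIntensity) = p.ltNLoS s R :=
  p.expNeg_lintegral_direct (k := fun r => 1 - p.pLOS r) (by fun_prop)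
    (fun _ hr => sub_nonneg.2 (p.pLOS_le_one hr)) p.CN_pos p.mN_pos hs hR

lemma secondPDF_eq (R₁ : ℝ) : p.secondPDF R₁ = (Ici R₁).indicator fun r =>
    2 * (p.lamBS * Real.pi) * r * Real.exp (-(p.lamBS * Real.pi * (r ^ 2 - R₁ ^ 2))) := by
  ext r
  simp [secondPDF, indicator]

lemma nearestPDF_eq : p.nearestPDF = (Ici 0).indicator fun r =>
    2 * Real.pi * p.lamBS * r * Real.exp (-(Real.pi * p.lamBS * r ^ 2)) := by
  ext r
  simp [nearestPDF, indicator]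

end Params

lemma anglePDF_eq : anglePDF = (Icc 0 Real.pi).indicator fun _ => 1 / Real.pi := by
  ext b
  simp [anglePDF, indicator]

lemma cos_half_nonneg {b : ℝ} (hb : b ∈ Icc 0 Real.pi) : 0 ≤ Real.cos (b / 2) :=
  Real.cos_nonneg_of_neg_pi_div_two_le_of_le (by linarith [hb.1, Real.pi_pos]) (by linarith [hb.2])

/-! ### Integration over protection radii and bistatic angle -/

namespace Sources.IsModel

variable {Ω : Type*} {S : Sources Ω} [MeasurableSpace Ω] {p : Params} {xt : Plane} {R₁ : ℝ}
  {μ : Measure Ω}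

/-- Makes `cos (β / 2)` nonnegative almost surely, which the scaling identities for `ENNReal.ofReal`
require. -/
lemma ae_β_mem (hS : S.IsModel p xt R₁ μ) : ∀ᵐ ω ∂μ, S.β ω ∈ Icc 0 Real.pi := by
  have h := ae_mem_lawOfPDF measurableSet_Icc measurable_const anglePDF_eq
  rw [← hS.β.2.map_eq] at h
  exact ae_of_ae_map hS.β.1.aemeasurable h

variable [IsProbabilityMeasure μ]

lemma lintegral_expNeg_ic_eq (hS : S.IsModel p xt R₁ μ) (hR₁ : 0 < R₁) {A : Set Plane}
    (hA : MeasurableSet A) (hvol : volume A = ENNReal.ofReal (p.cellArea R₁)) {s : ℝ}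
    (hs : 0 ≤ s) :
    ∫⁻ ω, expNeg (pairShot (p.icWeight xt s) (p.icWeight xt s) (S.icData A ω)) ∂μ
      = p.ltInter R₁ s := by
  have := isProbabilityMeasure_expMeasure (one_div_pos.2 p.σcl_pos)
  have := isProbabilityMeasure_expMeasure (one_div_pos.2 p.σt_pos)
  have hβ : IsProbabilityMeasure (lawOfPDF anglePDF) :=
    hS.β.2.map_eq ▸ Measure.isProbabilityMeasure_map hS.β.1.aemeasurable
  have hRic : IsProbabilityMeasure (lawOfPDF (p.secondPDF R₁)) :=
    hS.Ric.2.map_eq ▸ Measure.isProbabilityMeasure_map hS.Ric.1.aemeasurable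
  have hg := p.measurable_icWeight xt s
  rw [hS.lintegral_expNeg_ic hA hg, (indepFun_iff_map_prod_eq_prod_map_map hS.Ric.1.aemeasurable
    hS.β.1.aemeasurable).1 hS.indepFun_Ric_β, hS.Ric.2.map_eq, hS.β.2.map_eq]
  have m₁ : Measurable fun u => expNeg (∫⁻ x, 1 - laplace (expMeasure (1 / p.σt))
      (p.icWeight xt s u x) ∂(p.icIntensity xt)) :=
    measurable_expNeg.comp (Measurable.lintegral_prod_right' (f := fun q : (ℝ × ℝ) × Plane =>
      1 - laplace (expMeasure (1 / p.σt)) (p.icWeight xt s q.1 q.2)) (by fun_prop))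
  have m₂ : Measurable fun u => expNeg (∫⁻ x, 1 - expNeg (p.clutterIntensity A *
      (1 - laplace (expMeasure (1 / p.σcl)) (p.icWeight xt s u x))) ∂(p.icIntensity xt)) :=
    measurable_expNeg.comp (Measurable.lintegral_prod_right' (f := fun q : (ℝ × ℝ) × Plane =>
      1 - expNeg (p.clutterIntensity A *
        (1 - laplace (expMeasure (1 / p.σcl)) (p.icWeight xt s q.1 q.2)))) (by fun_prop))
  rw [lintegral_prod _ (by exact (m₁.mul m₂).aemeasurable),
    lintegral_lawOfPDF measurableSet_Ici (by fun_prop) (p.secondPDF_eq R₁),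
    ← setLIntegral_congr Ioi_ae_eq_Ici, Params.ltInter]
  refine setLIntegral_congr_fun measurableSet_Ioi fun r (hr : R₁ < r) => ?_
  have hr0 : 0 < r := hR₁.trans hr
  have hl := p.lamBS_pos
  rw [lintegral_lawOfPDF measurableSet_Icc measurable_const anglePDF_eq,
    ← lintegral_const_mul' _ _ ENNReal.ofReal_ne_top]
  refine setLIntegral_congr_fun measurableSet_Icc fun b hb => ?_
  have hc := cos_half_nonneg hb
  rw [p.expNeg_lintegral_ic1 xt hs hr0 hc, p.expNeg_lintegral_ic2 xt hR₁ hvol hs hr0 hc,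
    ← mul_assoc, ← ENNReal.ofReal_mul (by positivity), mul_comm]
  -- The angular density `1/π` cancels the `π` in the density of the radius.
  congr 2
  field_simp

lemma lintegral_expNeg_direct_eq (hS : S.IsModel p xt R₁ μ) {s : ℝ} (hs : 0 ≤ s) :
    ∫⁻ ω, expNeg (pairShot (p.directWeight p.CL p.ηL s) (p.directWeight p.CN p.ηN s)
      (S.directData ω)) ∂μ = p.ltDirect s := by
  rw [hS.lintegral_expNeg_direct (p.measurable_directWeight _ _ s)
    (p.measurable_directWeight _ _ s), hS.Rd.2.map_eq,
    lintegral_lawOfPDF measurableSet_Ici (by fun_prop) p.nearestPDF_eq,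
    ← setLIntegral_congr Ioi_ae_eq_Ici, Params.ltDirect]
  -- The open half-line omits the null radius `0`, which the polar formula excludes.
  refine setLIntegral_congr_fun measurableSet_Ioi fun r (hr : 0 < r) => ?_
  rw [p.expNeg_lintegral_los hs hr, p.expNeg_lintegral_nlos hs hr, mul_comm]

end Sources.IsModel

end ISAC

namespace ISAC

open Set

/-! ### The components of the SINR as shot noises -/

lemma PointProcess.const_mul_sumIn {Ω E : Type*} (Φ : PointProcess Ω E) (B : Set E)
    (f : ℕ → E → ℝ≥0∞) (a : ℝ≥0∞) (ω : Ω) :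
    a * Φ.sumIn B f ω = Φ.sumIn B (fun i x => a * f i x) ω := ENNReal.tsum_mul_left.symm

lemma PointProcess.sumIn_eq_pointSum_of_weight {Ω E : Type*} (Φ : PointProcess Ω E) {B : Set E}
    {f : ℕ → E → ℝ≥0∞} {g : E → ℝ≥0∞} {y : ℕ → ℝ≥0∞} (ω : Ω)
    (h : ∀ i, ∀ x ∈ B, f i x = g x * y i) :
    Φ.sumIn B f ω = pointSum (Φ.cfg ω) fun i x => B.indicator g x * y i := by
  rw [Φ.sumIn_eq_pointSum]
  congr with i x
  by_cases hx : x ∈ B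
  · simp [hx, h i x hx]
  · simp [hx]

namespace Params

variable (p : Params) {R₁ φ : ℝ}

lemma sIC_nonneg (hR₁ : 0 < R₁) (hφ : 0 < φ) : 0 ≤ p.sIC R₁ φ := by
  have := p.σt_pos
  unfold sIC
  positivity

lemma sD_pos (hR₁ : 0 < R₁) (hφ : 0 < φ) : 0 < p.sD R₁ φ := by
  have := p.σt_pos; have := p.Ps_pos; have := p.Gm_pos; have := p.wavelength_pos
  unfold sD
  positivity

lemma sD_mul_intra (hR₁ : 0 < R₁) (σ : ℝ) :
    p.sD R₁ φ * (p.Ps * p.Gm ^ 2 * σ * p.wavelength ^ 2 /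
      ((4 * Real.pi) ^ 3 * R₁ ^ (2 * p.ηL))) = φ / p.σt * σ := by
  have := p.σt_pos; have := p.Ps_pos; have := p.Gm_pos; have := p.wavelength_pos
  have := Real.rpow_pos_of_pos hR₁ (2 * p.ηL)
  unfold sD
  field_simp

/-- One of the two factors `R₁ ^ p.ηL` in `sD` cancels, which is why inter-clutter is evaluated at
`sIC`. -/
lemma sD_mul_echo (hR₁ : 0 < R₁) (σ b d : ℝ) (hd : 0 ≤ d) :
    p.sD R₁ φ * (p.Ps * p.Gm ^ 2 * (σ * Real.cos (b / 2)) * p.wavelength ^ 2 /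
      ((4 * Real.pi) ^ 3 * R₁ ^ p.ηL * d ^ p.ηL))
      = p.sIC R₁ φ * (Real.cos (b / 2) * d ^ (-p.ηL) * σ) := by
  have := p.σt_pos; have := p.Ps_pos; have := p.Gm_pos; have := p.wavelength_pos
  have := Real.rpow_pos_of_pos hR₁ p.ηL
  have h2 : R₁ ^ (2 * p.ηL) = R₁ ^ p.ηL * R₁ ^ p.ηL := by
    rw [two_mul, Real.rpow_add hR₁]
  unfold sD sIC
  -- The power of `d` is isolated as an inverse so that `d = 0` needs no separate case.
  rw [h2, Real.rpow_neg hd, div_mul_eq_mul_div, div_mul_eq_mul_div, mul_comm (_ * _) (d ^ p.ηL),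
    ← div_div _ (d ^ p.ηL), div_eq_mul_inv _ (d ^ p.ηL)]
  field_simp

end Params

namespace Sources

variable {Ω : Type*} (S : Sources Ω) (p : Params) (xt : Plane) (A : Set Plane) {R₁ φ : ℝ}

lemma ic2Mark_eq (n : ℕ) (ω : Ω) : S.ic2Mark A n ω =
    (S.ic2Clutter n).sumIn A (fun i _ => ENNReal.ofReal (S.ic2RCS n i ω)) ω :=
  ((S.ic2Clutter n).sumIn_eq_pointSum_of_weight ω fun _ _ _ => by
    rw [Pi.one_apply, one_mul, ic2ClutterMark]).symm

lemma clutterSum_eq (ω : Ω) : S.clutterSum A ω =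
    pointSum (S.clutter.cfg ω) fun i x => A.indicator 1 x * S.clutterMark i ω :=
  S.clutter.sumIn_eq_pointSum_of_weight ω fun _ _ _ => by
    rw [Pi.one_apply, one_mul, clutterMark]

lemma mul_IIC_eq {s : ℝ} (hs : 0 ≤ s) (ω : Ω) (hβ : 0 ≤ Real.cos (S.β ω / 2)) :
    ENNReal.ofReal s * (S.IIC1 p xt ω + S.IIC2 p xt A ω)
      = pairShot (p.icWeight xt s) (p.icWeight xt s) (S.icData A ω) := by
  -- `ENNReal.ofReal_mul` needs only its first factor nonnegative, so the RCS may have any sign: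
  -- both sides truncate it alike.
  have hw : ∀ x : Plane, 0 ≤ Real.cos (S.β ω / 2) * dist x xt ^ (-p.ηL) := fun x => by positivity
  rw [mul_add, IIC1, IIC2, PointProcess.const_mul_sumIn, PointProcess.const_mul_sumIn]
  refine congrArg₂ (· + ·) (S.ic1.sumIn_eq_pointSum_of_weight ω fun i x _ => ?_)
    (S.ic2.sumIn_eq_pointSum_of_weight ω fun i x _ => ?_)
  · rw [ENNReal.ofReal_mul (hw x), ← mul_assoc, ← ENNReal.ofReal_mul hs, ← mul_assoc]
    rfl
  · rw [← ic2Mark_eq, ← mul_assoc, ← ENNReal.ofReal_mul hs, ← mul_assoc]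
    rfl

lemma mul_direct_eq {s : ℝ} (hs : 0 ≤ s) (ω : Ω) :
    ENNReal.ofReal s * (S.directLoS p ω + S.directNLoS p ω)
      = pairShot (p.directWeight p.CL p.ηL s) (p.directWeight p.CN p.ηN s) (S.directData ω) := by
  have key : ∀ {C η : ℝ}, 0 < C → ∀ (h : ℝ) (x : Plane),
      ENNReal.ofReal s * ENNReal.ofReal (p.Pc * h * p.Gm ^ 2 * C * ‖x‖ ^ (-η))
        = ENNReal.ofReal (s * p.Pc * p.Gm ^ 2 * C * dist x 0 ^ (-η)) * ENNReal.ofReal h := by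
    intro C η hC h x
    have := p.Pc_nonneg
    rw [dist_zero_right, ← ENNReal.ofReal_mul hs, ← ENNReal.ofReal_mul (by positivity)]
    congr 1
    ring
  rw [mul_add, directLoS, directNLoS, PointProcess.const_mul_sumIn, PointProcess.const_mul_sumIn]
  simp_rw [← fun x : Plane => dist_zero_right x] at key ⊢
  exact congrArg₂ (· + ·)
    (S.los.sumIn_eq_pointSum_of_weight ω fun i x _ => key p.CL_pos (S.hL i ω) x)
    (S.nlos.sumIn_eq_pointSum_of_weight ω fun i x _ => key p.CN_pos (S.hN i ω) x)

lemma sD_mul_intraClutter (hR₁ : 0 < R₁) (hφ : 0 < φ) (ω : Ω) :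
    ENNReal.ofReal (p.sD R₁ φ) * S.intraClutter p A R₁ ω
      = ENNReal.ofReal (φ / p.σt) * S.clutterSum A ω := by
  rw [intraClutter, clutterSum, PointProcess.const_mul_sumIn, PointProcess.const_mul_sumIn]
  congr with i x
  rw [← ENNReal.ofReal_mul (p.sD_pos hR₁ hφ).le, p.sD_mul_intra hR₁,
    ENNReal.ofReal_mul (div_pos hφ p.σt_pos).le]

lemma sD_mul_echoPower (hR₁ : 0 < R₁) (hφ : 0 < φ) (σ b : ℝ) (x : Plane) :
    ENNReal.ofReal (p.sD R₁ φ) * echoPower p (bistaticRCS σ b) R₁ (dist x xt)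
      = ENNReal.ofReal (p.sIC R₁ φ) *
        ENNReal.ofReal (Real.cos (b / 2) * dist x xt ^ (-p.ηL) * σ) := by
  rw [echoPower, bistaticRCS, ← ENNReal.ofReal_mul (p.sD_pos hR₁ hφ).le,
    p.sD_mul_echo hR₁ _ _ _ dist_nonneg, ENNReal.ofReal_mul (p.sIC_nonneg hR₁ hφ)]

lemma sD_mul_interClutter1 (hR₁ : 0 < R₁) (hφ : 0 < φ) (ω : Ω) :
    ENNReal.ofReal (p.sD R₁ φ) * S.interClutter1 p xt R₁ ω
      = ENNReal.ofReal (p.sIC R₁ φ) * S.IIC1 p xt ω := by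
  rw [interClutter1, IIC1, PointProcess.const_mul_sumIn, PointProcess.const_mul_sumIn]
  simp_rw [sD_mul_echoPower p xt hR₁ hφ]

lemma sD_mul_interClutter2 (hR₁ : 0 < R₁) (hφ : 0 < φ) (ω : Ω)
    (hβ : 0 ≤ Real.cos (S.β ω / 2)) :
    ENNReal.ofReal (p.sD R₁ φ) * S.interClutter2 p xt A R₁ ω
      = ENNReal.ofReal (p.sIC R₁ φ) * S.IIC2 p xt A ω := by
  rw [interClutter2, IIC2, PointProcess.const_mul_sumIn, PointProcess.const_mul_sumIn]
  congr with n x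
  have hw : 0 ≤ Real.cos (S.β ω / 2) * dist x xt ^ (-p.ηL) := by positivity
  simp_rw [PointProcess.const_mul_sumIn, sD_mul_echoPower p xt hR₁ hφ, ENNReal.ofReal_mul hw]

/-- The denominator of the SINR, scaled by `sD`. -/
noncomputable def scaledInterference (R₁ φ : ℝ) (ω : Ω) : ℝ≥0∞ :=
  ENNReal.ofReal (φ / p.σt) * S.clutterSum A ω
    + ENNReal.ofReal (p.sIC R₁ φ) * (S.IIC1 p xt ω + S.IIC2 p xt A ω)
    + ENNReal.ofReal (p.sD R₁ φ * (p.kB * p.T * p.Wb))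
    + ENNReal.ofReal (p.sD R₁ φ) * (S.directLoS p ω + S.directNLoS p ω)
    + ENNReal.ofReal (p.sD R₁ φ * (p.Pc * p.ζ))

lemma lt_sinr_iff (hR₁ : 0 < R₁) (hφ : 0 < φ) (ω : Ω) (hβ : 0 ≤ Real.cos (S.β ω / 2)) :
    ENNReal.ofReal φ < S.sinr p xt A R₁ ω ↔
      S.scaledInterference p xt A R₁ φ ω < ENNReal.ofReal (1 / p.σt * S.targetRCS ω) := by
  have hσ := p.σt_pos
  have hsD := p.sD_pos hR₁ hφ
  have hN : 0 < p.kB * p.T * p.Wb := mul_pos (mul_pos p.kB_pos p.T_pos) p.Wb_pos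
  rw [sinr]
  set D := S.intraClutter p A R₁ ω + S.interClutter1 p xt R₁ ω + S.interClutter2 p xt A R₁ ω
      + ENNReal.ofReal (p.kB * p.T * p.Wb) + S.directLoS p ω + S.directNLoS p ω
      + ENNReal.ofReal (p.Pc * p.ζ) with hD
  -- Thermal noise is strictly positive.
  have hD0 : D ≠ 0 := by
    rw [hD]
    have : ENNReal.ofReal (p.kB * p.T * p.Wb) ≠ 0 := by simpa using hN
    simp [this]
  have hscaled : S.scaledInterference p xt A R₁ φ ω = ENNReal.ofReal (p.sD R₁ φ) * D := by
    simp only [hD, scaledInterference, mul_add]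
    rw [S.sD_mul_intraClutter p A hR₁ hφ, S.sD_mul_interClutter1 p xt hR₁ hφ,
      S.sD_mul_interClutter2 p xt A hR₁ hφ ω hβ, ENNReal.ofReal_mul hsD.le,
      ENNReal.ofReal_mul hsD.le]
    ring
  have hsig : ENNReal.ofReal (1 / p.σt * S.targetRCS ω)
      = ENNReal.ofReal (p.sD R₁ φ / φ) * S.signal p R₁ ω := by
    rw [signal, ← ENNReal.ofReal_mul (by positivity), div_mul_eq_mul_div (p.sD R₁ φ),
      p.sD_mul_intra hR₁]
    congr 1
    field_simp
  have hsplit : ENNReal.ofReal (p.sD R₁ φ) = ENNReal.ofReal (p.sD R₁ φ / φ) * ENNReal.ofReal φ := by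
    rw [← ENNReal.ofReal_mul (by positivity), div_mul_cancel₀ _ hφ.ne']
  have hc : 0 < p.sD R₁ φ / φ := by positivity
  -- An infinite denominator is covered because `φ > 0`: both inequalities then fail.
  rw [ENNReal.lt_div_iff_mul_lt (Or.inl hD0) (Or.inr (by simpa using hφ)), hscaled, hsig, hsplit,
    mul_assoc, ENNReal.mul_lt_mul_iff_right (by simpa using hc) ENNReal.ofReal_ne_top]

end Sources

end ISAC

namespace ISAC

/-! ### Factorization of the coverage probability -/

section Independence

variable {Ω α β γ : Type*} [MeasurableSpace Ω] [MeasurableSpace α] [MeasurableSpace β]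
  [MeasurableSpace γ] {μ : Measure Ω}

lemma lintegral_mul_comp_of_indepFun {X : Ω → α} {Y : Ω → β} (hX : Measurable X)
    (hY : Measurable Y) (h : IndepFun X Y μ) {f : α → ℝ≥0∞} {g : β → ℝ≥0∞} (hf : Measurable f)
    (hg : Measurable g) :
    ∫⁻ ω, f (X ω) * g (Y ω) ∂μ = (∫⁻ ω, f (X ω) ∂μ) * ∫⁻ ω, g (Y ω) ∂μ :=
  lintegral_mul_eq_lintegral_mul_lintegral_of_indepFun (hf.comp hX) (hg.comp hY) (h.comp hf hg)

lemma lintegral_expNeg_add_of_indepFun {X : Ω → α} {Y : Ω → β} {Z : Ω → γ} (hX : Measurable X)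
    (hY : Measurable Y) (hZ : Measurable Z) (h : IndepFun X (fun ω => (Y ω, Z ω)) μ)
    (h' : IndepFun Y Z μ) {f : α → ℝ≥0∞} {g : β → ℝ≥0∞} {k : γ → ℝ≥0∞} (hf : Measurable f)
    (hg : Measurable g) (hk : Measurable k) (c₁ c₂ : ℝ≥0∞) :
    ∫⁻ ω, expNeg (f (X ω) + g (Y ω) + c₁ + k (Z ω) + c₂) ∂μ
      = (∫⁻ ω, expNeg (f (X ω)) ∂μ) * (∫⁻ ω, expNeg (g (Y ω)) ∂μ) * expNeg c₁ *
        (∫⁻ ω, expNeg (k (Z ω)) ∂μ) * expNeg c₂ := by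
  have hsplit : ∀ ω, expNeg (f (X ω) + g (Y ω) + c₁ + k (Z ω) + c₂) = expNeg c₁ * expNeg c₂ *
      (expNeg (f (X ω)) * (expNeg (g (Y ω)) * expNeg (k (Z ω)))) := fun ω => by
    simp only [expNeg_add]
    ring
  rw [lintegral_congr hsplit, lintegral_const_mul _ (by fun_prop),
    lintegral_mul_comp_of_indepFun (f := fun x => expNeg (f x))
      (g := fun q : β × γ => expNeg (g q.1) * expNeg (k q.2)) hX (hY.prodMk hZ) h (by fun_prop)
      (by fun_prop),
    lintegral_mul_comp_of_indepFun (f := fun x => expNeg (g x)) (g := fun x => expNeg (k x)) hY hZ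
      h' (by fun_prop) (by fun_prop)]
  ring

end Independence

namespace Sources.IsModel

variable {Ω : Type*} {S : Sources Ω} [MeasurableSpace Ω] {p : Params} {xt : Plane} {R₁ : ℝ}
  {μ : Measure Ω} [IsProbabilityMeasure μ]

/-- With `J` frozen, the normalized target RCS has a unit exponential tail. This is the only use of
the law of `targetRCS`. -/
lemma measure_lt_targetRCS (hS : S.IsModel p xt R₁ μ) {J : Ω → ℝ≥0∞} (hJm : Measurable J)
    (hJ : IndepFun J S.targetRCS μ) :
    μ {ω | J ω < ENNReal.ofReal (1 / p.σt * S.targetRCS ω)} = ∫⁻ ω, expNeg (J ω) ∂μ := by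
  have hσ := p.σt_pos
  let F : ℝ≥0∞ × ℝ → ℝ≥0∞ := {q | q.1 < ENNReal.ofReal (1 / p.σt * q.2)}.indicator 1
  have hset : MeasurableSet {q : ℝ≥0∞ × ℝ | q.1 < ENNReal.ofReal (1 / p.σt * q.2)} :=
    measurableSet_lt (by fun_prop) (by fun_prop)
  have hF : Measurable F := measurable_one.indicator hset
  have hX := hS.targetRCS.1
  have h1 : ∫⁻ ω, F (J ω, S.targetRCS ω) ∂μ
      = μ {ω | J ω < ENNReal.ofReal (1 / p.σt * S.targetRCS ω)} :=
    lintegral_indicator_one (hset.preimage (hJm.prodMk hX))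
  have h2 : ∀ d, ∫⁻ ω, F (d, S.targetRCS ω) ∂μ = expNeg d := fun d => by
    have hd : MeasurableSet {x : ℝ | d < ENNReal.ofReal (1 / p.σt * x)} :=
      measurableSet_lt (by fun_prop) (by fun_prop)
    have h3 : ∫⁻ ω, F (d, S.targetRCS ω) ∂μ
        = μ {ω | d < ENNReal.ofReal (1 / p.σt * S.targetRCS ω)} :=
      lintegral_indicator_one (hd.preimage hX)
    rw [h3, hS.targetRCS.2.measure_eq hd,
      expMeasure_lt_ofReal (one_div_pos.2 hσ) (one_div_pos.2 hσ), div_self (by positivity)]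
    simp
  rw [← h1, lintegral_comp_of_indepFun hJm hX hJ hF]
  simp_rw [h2]
  exact lintegral_map measurable_expNeg hJm

end Sources.IsModel

end ISAC

theorem theorem1 {Ω : Type*} [MeasurableSpace Ω] (μ : Measure Ω) [IsProbabilityMeasure μ]
    (p : ISAC.Params) (R₁ φ : ℝ) (hR₁ : 0 < R₁) (hφ : 0 < φ)
    (xt : ISAC.Plane) (hxt : ‖xt‖ = R₁)
    (A : Set ISAC.Plane) (hA : MeasurableSet A)
    (hvol : volume A = ENNReal.ofReal (p.cellArea R₁))
    (S : ISAC.Sources Ω) (hS : S.IsModel p xt R₁ μ) :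
    -- the coverage probability
    μ {ω | ENNReal.ofReal φ < S.sinr p xt A R₁ ω} =
      p.ltIntra R₁ φ * p.ltInter R₁ (p.sIC R₁ φ) *
        ENNReal.ofReal (Real.exp (-(φ * (4 * Real.pi) ^ 3 * R₁ ^ (2 * p.ηL) *
          (p.kB * p.T * p.Wb) / (p.Ps * p.Gm ^ 2 * p.wavelength ^ 2 * p.σt)))) *
        p.ltDirect (p.sD R₁ φ) *
        ENNReal.ofReal (Real.exp (-(φ * (4 * Real.pi) ^ 3 * R₁ ^ (2 * p.ηL) *
          (p.Pc * p.ζ) / (p.Ps * p.Gm ^ 2 * p.wavelength ^ 2 * p.σt)))) ∧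
    -- the factors are the Laplace transforms of the components of the interference
    ∫⁻ ω, ISAC.expNeg (ENNReal.ofReal (φ / p.σt) * S.clutterSum A ω) ∂μ = p.ltIntra R₁ φ ∧
    ∫⁻ ω, ISAC.expNeg (ENNReal.ofReal (p.sIC R₁ φ) * (S.IIC1 p xt ω + S.IIC2 p xt A ω)) ∂μ =
      p.ltInter R₁ (p.sIC R₁ φ) ∧
    ∫⁻ ω, ISAC.expNeg (ENNReal.ofReal (p.sD R₁ φ) * (S.directLoS p ω + S.directNLoS p ω)) ∂μ =
      p.ltDirect (p.sD R₁ φ) := by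
  open ISAC in
  have hσ := p.σt_pos
  have hσcl := p.σcl_pos
  have hsD := p.sD_pos hR₁ hφ
  have hsIC := p.sIC_nonneg hR₁ hφ
  have hcos : ∀ᵐ ω ∂μ, 0 ≤ Real.cos (S.β ω / 2) :=
    hS.ae_β_mem.mono fun ω hω => cos_half_nonneg hω
  -- the three random components, as functions of independent random elements
  let fcl : (ℕ∞ × (ℕ → Plane)) × (ℕ → ℝ≥0∞) → ℝ≥0∞ := fun v =>
    ENNReal.ofReal (φ / p.σt) * pointSum v.1 fun i x => A.indicator 1 x * v.2 i
  let fic := pairShot (p.icWeight xt (p.sIC R₁ φ)) (p.icWeight xt (p.sIC R₁ φ))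
  let fd := pairShot (p.directWeight p.CL p.ηL (p.sD R₁ φ)) (p.directWeight p.CN p.ηN (p.sD R₁ φ))
  have mcl : Measurable fcl := (measurable_pointSum measurable_fst fun i =>
    ((measurable_one.indicator hA).comp measurable_snd).mul (by fun_prop)).const_mul _
  have mic : Measurable fic := measurable_pairShot (p.measurable_icWeight xt _)
    (p.measurable_icWeight xt _)
  have md : Measurable fd := measurable_pairShot (p.measurable_directWeight _ _ _)
    (p.measurable_directWeight _ _ _)
  have gcl : Measurable S.clutterData := (Sources.measurable_gen_clutterData
    (s := {1}) rfl).mono (hS.gen_le _) le_rfl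
  have gic : Measurable (S.icData A) := (Sources.measurable_gen_icData hA
    subset_rfl).mono (hS.gen_le _) le_rfl
  have gd : Measurable S.directData := (Sources.measurable_gen_directData
    subset_rfl).mono (hS.gen_le _) le_rfl
  have ecl : ∀ ω, ENNReal.ofReal (φ / p.σt) * S.clutterSum A ω = fcl (S.clutterData ω) :=
    fun ω => by rw [S.clutterSum_eq]; rfl
  have eic : ∀ᵐ ω ∂μ, ENNReal.ofReal (p.sIC R₁ φ) * (S.IIC1 p xt ω + S.IIC2 p xt A ω)
      = fic (S.icData A ω) := hcos.mono fun ω hω => S.mul_IIC_eq p xt A hsIC ω hω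
  have ed : ∀ ω, ENNReal.ofReal (p.sD R₁ φ) * (S.directLoS p ω + S.directNLoS p ω)
      = fd (S.directData ω) := fun ω => S.mul_direct_eq p hsD.le ω
  have Lcl : ∫⁻ ω, expNeg (fcl (S.clutterData ω)) ∂μ = p.ltIntra R₁ φ := by
    refine (lintegral_expNeg_clutter hS.isMarkedPoisson_clutter hA _).trans ?_
    rw [p.expNeg_clutter hR₁ hvol (by positivity), Params.ltIntra, Params.cellArea]
    congr 4
    field_simp
  have Lic : ∫⁻ ω, expNeg (fic (S.icData A ω)) ∂μ = p.ltInter R₁ (p.sIC R₁ φ) :=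
    hS.lintegral_expNeg_ic_eq hR₁ hA hvol hsIC
  have Ld : ∫⁻ ω, expNeg (fd (S.directData ω)) ∂μ = p.ltDirect (p.sD R₁ φ) :=
    hS.lintegral_expNeg_direct_eq hsD.le
  refine ⟨?_, by simp_rw [ecl, Lcl], ?_, by simp_rw [ed, Ld]⟩
  swap
  · rw [← Lic]
    exact lintegral_congr_ae (eic.mono fun ω hω => congrArg expNeg hω)
  let c₁ := ENNReal.ofReal (p.sD R₁ φ * (p.kB * p.T * p.Wb))
  let c₂ := ENNReal.ofReal (p.sD R₁ φ * (p.Pc * p.ζ))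
  let J : Ω → ℝ≥0∞ := fun ω =>
    fcl (S.clutterData ω) + fic (S.icData A ω) + c₁ + fd (S.directData ω) + c₂
  have hJm : Measurable J := ((((mcl.comp gcl).add (mic.comp gic)).add_const _).add
    (md.comp gd)).add_const _
  -- The interference uses only sources outside group `0`, which is the target RCS of the desired
  -- echo.
  have hJ : IndepFun J S.targetRCS μ := by
    refine hS.indepFun_group {0}ᶜ {0} (by simp) ?_
      (Sources.measurable_gen_real (ℓ := .targetRCS) rfl rfl)
    exact ((((mcl.comp (Sources.measurable_gen_clutterData (by simp))).add
      (mic.comp (Sources.measurable_gen_icData hA (by simp)))).add_const _).add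
      (md.comp (Sources.measurable_gen_directData (by simp)))).add_const _
  have hevent : μ {ω | ENNReal.ofReal φ < S.sinr p xt A R₁ ω}
      = μ {ω | J ω < ENNReal.ofReal (1 / p.σt * S.targetRCS ω)} := by
    refine measure_congr ?_
    filter_upwards [hcos, eic] with ω hω hω'
    refine propext ((S.lt_sinr_iff p xt A hR₁ hφ ω hω).trans ?_)
    rw [Sources.scaledInterference, ecl, hω', ed]
    rfl
  -- Nested independence suffices for three factors: intra-clutter against the rest, then
  -- inter-clutter against direct.
  have i₁ : IndepFun S.clutterData (fun ω => (S.icData A ω, S.directData ω)) μ :=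
    hS.indepFun_group {1} {2, 3, 4, 5, 6, 7, 8} (by simp) (Sources.measurable_gen_clutterData rfl)
      ((Sources.measurable_gen_icData hA (by grind)).prodMk
        (Sources.measurable_gen_directData (by grind)))
  have i₂ : IndepFun (S.icData A) S.directData μ :=
    hS.indepFun_group {5, 6, 7, 8} {2, 3, 4} (by simp)
      (Sources.measurable_gen_icData hA subset_rfl) (Sources.measurable_gen_directData subset_rfl)
  have hconst : ∀ y : ℝ, 0 ≤ y → expNeg (ENNReal.ofReal (p.sD R₁ φ * y)) =
      ENNReal.ofReal (Real.exp (-(φ * (4 * Real.pi) ^ 3 * R₁ ^ (2 * p.ηL) *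
        y / (p.Ps * p.Gm ^ 2 * p.wavelength ^ 2 * p.σt)))) := fun y hy => by
    rw [expNeg_ofReal (by positivity), Params.sD, div_mul_eq_mul_div]
  have hN : 0 ≤ p.kB * p.T * p.Wb := (mul_pos (mul_pos p.kB_pos p.T_pos) p.Wb_pos).le
  rw [hevent, hS.measure_lt_targetRCS hJm hJ, lintegral_expNeg_add_of_indepFun gcl gic gd i₁ i₂
    mcl mic md, Lcl, Lic, Ld, hconst _ hN, hconst _ (mul_nonneg p.Pc_nonneg p.ζ_nonneg)]
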